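/- Conventions. $\mathbb N=\{1,2,\dots\}$. A distribution is a probability distribution $\mu$ on $[n]=\{1,\dots,n\}$, $d(\mu,\chi)=\sum_{i\in[n]}|\mu(i)-\chi(i)|$, and a property $\mathcal C$ of distributions is, for each $n\in\mathbb N$, a set of distributions over $[n]$; $d(\mu,\mathcal C)=\inf_{\chi\in\mathcal C}d(\mu,\chi)$ over the $\chi\in\mathcal C$ on the same $[n]$ (with $\inf\emptyset=\infty$), and $\mu$ is $\epsilon$-far from $\mathcal C$ if $d(\mu,\chi)>\epsilon$ for all such $\chi$. An atlas over $[n]$ is a pair $(\mathcal I,\mathcal M)$ of a partition $\mathcal I=(I_1,\dots,I_\ell)$ of $[n]$ into consecutive nonempty intervals and a sequence $\mathcal M=(M_1,\dots,M_\ell)$ of multisets of nonnegative reals with $|M_j|=|I_j|$, all members of all the $M_j$ adding up to $1$; its length is $\ell$. A distribution $\mu$ over $[n]$ conforms to it if, for every $j$, $M_j$ is the multiset of the values $\mu(i)$, $i\in I_j$ (with repetitions). For a function $k:\mathbb R^+\times\mathbb N\to\mathbb N\cup\{0\}$, the property $\mathcal C$ is $k$-characterized by atlases if for every $n$ and every $\epsilon>0$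 there is a set $\mathbb A$ of atlases over $[n]$, of lengths at most $k(\epsilon,n)$, such that every distribution over $[n]$ in $\mathcal C$ conforms to some member of $\mathbb A$, and no distribution that conforms to a member of $\mathbb A$ is $\epsilon$-far from $\mathcal C$. A conditional sample from $\mu$ is obtained by choosing a nonempty set $A\subseteq[n]$ and receiving a point $i\in A$ drawn with probability $\mu(i)/\mu(A)$, or uniformly from $A$ if $\mu(A)=0$. An $(\eta,\epsilon)$-tolerant tester for $\mathcal C$ over $[n]$ that takes $q$ conditional samples is a randomized algorithm that makes $q$ conditional queries to an unknown distribution $\mu$ over $[n]$, each query set depending on the answers received so far and on internal coin tosses, and then accepts or rejects; it succeeds with probability at least $2/3$ if, for every $\mu$, it accepts with probability at least $2/3$ when $d(\mu,\mathcal C)\le\eta$, and rejects with probability at least $2/3$ when $d(\mu,\mathcal C)\ge\eta+\epsilon$. Theorem. There is a real polynomial $P$ in two variables such that the following holds. Let $\mathcal C$ be a property of distributions that is $k$-characterized by atlases. Then for all $\eta,\epsilon>0$ with $\eta+\epsilon<1$ and every $n\in\mathbb N$ there is an $(\eta,\epsilon)$-tolerant tester for $\mathcal C$ over $[n]$ that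 takes at most $k(\epsilon/5,n)\cdot P(\log n,1/\epsilon)$ conditional samples and succeeds with probability at least $2/3$. -/

import Mathlib

/-!
The domain `[n] = {1, …, n}` is represented by `Fin n`, and a probability distribution over `[n]`
is a `PMF (Fin n)`.
-/

/-- A property of distributions: for every `n`, the set of the distributions over `[n]` that
satisfy it. -/
abbrev DistProperty : Type := (n : ℕ) → Set (PMF (Fin n))

/-- The `ℓ₁` distance `d(μ, χ) = ∑ i, |μ(i) - χ(i)|`. -/
noncomputable def l1Dist {n : ℕ} (μ χ : PMF (Fin n)) : ℝ :=
  ∑ i, |(μ i).toReal - (χ i).toReal|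

/-- `d(μ, S) = inf_{χ ∈ S} d(μ, χ)`; it is `∞` when `S` is empty. -/
noncomputable def distToSet {n : ℕ} (μ : PMF (Fin n)) (S : Set (PMF (Fin n))) : ENNReal :=
  ⨅ χ ∈ S, ENNReal.ofReal (l1Dist μ χ)

/-- `μ` is `ε`-far from `S`: every `χ ∈ S` has `d(μ, χ) > ε`. -/
def IsFar {n : ℕ} (ε : ℝ) (μ : PMF (Fin n)) (S : Set (PMF (Fin n))) : Prop :=
  ∀ χ ∈ S, ε < l1Dist μ χ

/-- The inventory of `μ` over the `j`-th interval of an interval partition `I` of `[n]`: the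
multiset of the values of `μ` on that interval. A `Composition n` is exactly a partition of `[n]`
into consecutive nonempty intervals, listed from left to right; `I.embedding j` enumerates the
`j`-th of them. -/
noncomputable def inventory {n : ℕ} (μ : PMF (Fin n)) (I : Composition n) (j : Fin I.length) :
    Multiset ℝ :=
  (Finset.univ : Finset (Fin (I.blocksFun j))).val.map fun t => (μ (I.embedding j t)).toReal

/-- An atlas over `[n]`: an interval partition of `[n]` with a multiset of nonnegative numbers for
each interval, of the size of that interval, such that all members of all multisets add up
to `1`. -/
structure Atlas (n : ℕ) where
  partition : Composition n
  inventories : Fin partition.length → Multiset ℝ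
  card_eq : ∀ j, (inventories j).card = partition.blocksFun j
  nonneg : ∀ j, ∀ x ∈ inventories j, 0 ≤ x
  sum_eq_one : ∑ j, (inventories j).sum = 1

/-- The length of an atlas: the number of intervals in its partition. -/
def Atlas.length {n : ℕ} (A : Atlas n) : ℕ := A.partition.length

/-- `μ` conforms to `A`: the multisets of `A` are the inventories of `μ` over the intervals
of `A`. -/
def Conforms {n : ℕ} (μ : PMF (Fin n)) (A : Atlas n) : Prop :=
  ∀ j, A.inventories j = inventory μ A.partition j

/-- `C` is `k`-characterized by atlases. Only the values `k ε n` with `ε > 0` matter. -/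
def IsCharacterizedByAtlases (k : ℝ → ℕ → ℕ) (C : DistProperty) : Prop :=
  ∀ (n : ℕ) (ε : ℝ), 0 < ε → ∃ 𝔸 : Set (Atlas n),
    (∀ A ∈ 𝔸, A.length ≤ k ε n) ∧
    (∀ μ ∈ C n, ∃ A ∈ 𝔸, Conforms μ A) ∧
    (∀ A ∈ 𝔸, ∀ μ : PMF (Fin n), Conforms μ A → ¬ IsFar ε μ (C n))

open Classical in
/-- The answer of the conditional oracle of `μ` to a nonempty query set `A`: a point of `A` drawn
with probability `μ(i) / μ(A)`, or uniformly from `A` if `μ(A) = 0`. -/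
noncomputable def condOracle {n : ℕ} (μ : PMF (Fin n)) (A : Finset (Fin n)) (hA : A.Nonempty) :
    PMF (Fin n) :=
  if h : ∃ i ∈ (A : Set (Fin n)), i ∈ μ.support then μ.filter (A : Set (Fin n)) h
  else PMF.uniformOfFinset A hA

/-- Randomized adaptive algorithms that call the conditional oracle exactly `q` times (on every
branch) and then accept (`true`) or reject (`false`). At any time such an algorithm may toss
internal coins, that is, draw from a known discrete distribution `p`; a query set and the final
answer may depend on all earlier oracle answers and coin tosses. -/
inductive CondAlg (n : ℕ) : ℕ → Type
  | output (accept : Bool) : CondAlg n 0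
  | toss {q : ℕ} (p : PMF ℕ) (next : ℕ → CondAlg n q) : CondAlg n q
  | query {q : ℕ} (A : Finset (Fin n)) (hA : A.Nonempty) (next : Fin n → CondAlg n q) :
      CondAlg n (q + 1)

/-- The distribution of the answer of an algorithm that is run on the conditional oracle
of `μ`. -/
noncomputable def CondAlg.run {n : ℕ} (μ : PMF (Fin n)) : {q : ℕ} → CondAlg n q → PMF Bool
  | _, .output b => PMF.pure b
  | _, .toss p next => p.bind fun c => (next c).run μ
  | _, .query A hA next => (condOracle μ A hA).bind fun i => (next i).run μ

/-- `T` is an `(η, ε)`-tolerant tester, with error probability `δ`, for the set `S` of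
distributions over `[n]`. -/
def IsTolerantTester {n q : ℕ} (T : CondAlg n q) (S : Set (PMF (Fin n))) (η ε δ : ℝ) : Prop :=
  ∀ μ : PMF (Fin n),
    (distToSet μ S ≤ ENNReal.ofReal η → 1 - δ ≤ (T.run μ true).toReal) ∧
    (ENNReal.ofReal (η + ε) ≤ distToSet μ S → 1 - δ ≤ (T.run μ false).toReal)

/-! Permuting a distribution inside the intervals of an atlas keeps conformity, so a member `χ` of
the property, permuted this way, stays `ε/5`-close to the property. Hence it suffices to learn `μ`
up to a small `ℓ₁` error and up to a permutation that preserves every interval of an unknown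
partition into at most `k` intervals (`distToSet_lt_of_perm`).

This takes two batches of samples. About `k`, up to polylogarithmic factors, points of `μ` cut `[n]`
into cells; a cell with several points is light, so for each partition the cells that cross its
boundaries carry little mass (`sum_crossing_le`). Then further points are drawn, each with an
estimate of its own probability, and only the pair (cell, rounded logarithm of the estimate) is
kept. There are few such labels, so their empirical distribution is accurate
(`PMF.prob_iid_empirical_le`).

The estimate of `μ i` multiplies empirical conditional probabilities along a chain of halvings of
`[n]` towards `i`. It may be poor for some `i`, but the relative variance averaged over `i` drawn
from `μ` is small (`sum_mul_sum_expect_estimate_sq_le`), and only typical points matter.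

If one transcript is typical for both `μ` and `ν`, their label distributions nearly agree. Coupling
equally labelled points pairs, up to small mass, points of the same interval and of nearly equal
weight. Birkhoff's theorem turns the coupling into an interval-preserving permutation
(`exists_perm_of_subcoupling`, `exists_perm_of_isTypical`). The tester accepts when the transcript
is typical for some `ν` within `η` of the property. -/

open scoped ENNReal

/-! ### Expectations of extended nonnegative functions -/

namespace PMF

variable {α β : Type*}

/-- The expectation of an extended nonnegative function. -/
noncomputable def expect (p : PMF α) (f : α → ℝ≥0∞) : ℝ≥0∞ := ∑' a, p a * f a

/-- The probability of a set. -/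
noncomputable def prob (p : PMF α) (s : Set α) : ℝ≥0∞ := p.expect (s.indicator 1)

theorem expect_pure (a : α) (f : α → ℝ≥0∞) : (pure a).expect f = f a := by
  classical
  unfold expect
  rw [tsum_eq_single a]
  · simp
  · intro b hb
    simp [hb]

theorem expect_bind (p : PMF α) (g : α → PMF β) (f : β → ℝ≥0∞) :
    (p.bind g).expect f = p.expect fun a => (g a).expect f := by
  unfold expect
  simp only [bind_apply, ← ENNReal.tsum_mul_right, ← ENNReal.tsum_mul_left]
  rw [ENNReal.tsum_comm]
  simp only [mul_assoc]

theorem expect_map (p : PMF α) (g : α → β) (f : β → ℝ≥0∞) :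
    (p.map g).expect f = p.expect fun a => f (g a) := by
  rw [← bind_pure_comp, expect_bind]
  simp [expect_pure]

theorem expect_add (p : PMF α) (f g : α → ℝ≥0∞) :
    (p.expect fun a => f a + g a) = p.expect f + p.expect g := by
  unfold expect
  simp only [mul_add]
  exact ENNReal.tsum_add

theorem expect_const_mul (p : PMF α) (c : ℝ≥0∞) (f : α → ℝ≥0∞) :
    (p.expect fun a => c * f a) = c * p.expect f := by
  unfold expect
  rw [← ENNReal.tsum_mul_left]
  exact tsum_congr fun a => by ring

theorem expect_const (p : PMF α) (c : ℝ≥0∞) : (p.expect fun _ => c) = c := by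
  unfold expect
  rw [ENNReal.tsum_mul_right, p.tsum_coe, one_mul]

theorem expect_mono_of_ne_zero (p : PMF α) {f g : α → ℝ≥0∞} (h : ∀ a, p a ≠ 0 → f a ≤ g a) :
    p.expect f ≤ p.expect g := by
  refine ENNReal.tsum_le_tsum fun a => ?_
  by_cases ha : p a = 0
  · simp [ha]
  · exact mul_le_mul_right (h a ha) _

theorem expect_mono (p : PMF α) {f g : α → ℝ≥0∞} (h : ∀ a, f a ≤ g a) :
    p.expect f ≤ p.expect g :=
  p.expect_mono_of_ne_zero fun a _ => h a

theorem expect_finset_sum {ι : Type*} (p : PMF α) (s : Finset ι) (f : ι → α → ℝ≥0∞) :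
    (p.expect fun a => ∑ i ∈ s, f i a) = ∑ i ∈ s, p.expect (f i) := by
  classical
  induction s using Finset.induction_on with
  | empty => simp [expect]
  | insert i s hi ih => simp only [Finset.sum_insert hi, expect_add, ih]

theorem expect_fintype [Fintype α] (p : PMF α) (f : α → ℝ≥0∞) :
    p.expect f = ∑ a, p a * f a := tsum_fintype _

theorem prob_bind (p : PMF α) (g : α → PMF β) (s : Set β) :
    (p.bind g).prob s = p.expect fun a => (g a).prob s :=
  expect_bind p g _

theorem prob_map (p : PMF α) (g : α → β) (s : Set β) : (p.map g).prob s = p.prob (g ⁻¹' s) :=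
  expect_map p g _

theorem prob_pure (a : α) (s : Set α) : (pure a).prob s = s.indicator 1 a := expect_pure a _

theorem prob_mono (p : PMF α) {s t : Set α} (h : s ⊆ t) : p.prob s ≤ p.prob t :=
  p.expect_mono fun a => Set.indicator_le_indicator_of_subset h (fun _ => zero_le) a

theorem prob_le_one (p : PMF α) (s : Set α) : p.prob s ≤ 1 := by
  refine (p.expect_mono (g := fun _ => 1) fun a => ?_).trans_eq (p.expect_const 1)
  exact Set.indicator_le_self' (fun _ _ => zero_le) a

theorem prob_add_prob_compl (p : PMF α) (s : Set α) : p.prob s + p.prob sᶜ = 1 := by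
  unfold prob
  rw [← expect_add, ← p.expect_const 1]
  congr 1
  funext a
  by_cases ha : a ∈ s <;> simp [ha]

theorem prob_biUnion_le {ι : Type*} (p : PMF α) (I : Finset ι) (s : ι → Set α) :
    p.prob (⋃ i ∈ I, s i) ≤ ∑ i ∈ I, p.prob (s i) := by
  unfold prob
  rw [← expect_finset_sum]
  refine p.expect_mono fun a => ?_
  by_cases ha : a ∈ ⋃ i ∈ I, s i
  · rw [Set.indicator_of_mem ha]
    simp only [Set.mem_iUnion] at ha
    obtain ⟨i, hi, hai⟩ := ha
    refine le_trans ?_ (Finset.single_le_sum (fun _ _ => zero_le) hi)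
    rw [Set.indicator_of_mem hai]
  · rw [Set.indicator_of_notMem ha]
    exact zero_le

theorem mul_prob_le_expect (p : PMF α) (f : α → ℝ≥0∞) (c : ℝ≥0∞) :
    c * p.prob {a | c ≤ f a} ≤ p.expect f := by
  unfold prob
  rw [← expect_const_mul]
  refine p.expect_mono fun a => ?_
  by_cases ha : c ≤ f a <;> simp [ha]

theorem prob_singleton (p : PMF α) (a : α) : p.prob {a} = p a := by
  unfold prob expect
  rw [tsum_eq_single a]
  · simp
  · intro b hb
    simp [hb]

theorem prob_finset (p : PMF α) (s : Finset α) : p.prob (s : Set α) = ∑ a ∈ s, p a := by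
  classical
  unfold prob expect
  rw [tsum_eq_sum (s := s)]
  · exact Finset.sum_congr rfl fun a ha => by simp [ha]
  · intro b hb
    simp [hb]

/-! ### Independent samples -/

/-- The law of `N` independent samples. -/
noncomputable def iid (p : PMF α) : ℕ → PMF (List α)
  | 0 => pure []
  | N + 1 => p.bind fun a => (iid p N).map (List.cons a)

theorem iid_map (p : PMF α) (g : α → β) (N : ℕ) : (p.map g).iid N = (p.iid N).map (List.map g) := by
  induction N with
  | zero => simp [iid, pure_map]
  | succ N ih =>
    simp only [iid, ih, bind_map, map_bind, map_comp]
    rfl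

variable (s : Set α) [DecidablePred (· ∈ s)]

theorem expect_countP_iid (p : PMF α) (N : ℕ) :
    ((p.iid N).expect fun l => (l.countP (· ∈ s) : ℝ≥0∞)) = N * p.prob s := by
  induction N with
  | zero => simp [iid, expect_pure]
  | succ N ih =>
    have h : ∀ (a : α) (l : List α), (((a :: l).countP (· ∈ s) : ℕ) : ℝ≥0∞) =
        l.countP (· ∈ s) + s.indicator 1 a := by
      intro a l
      by_cases ha : a ∈ s <;> simp [ha]
    simp only [iid, expect_bind, expect_map, h, expect_add, ih, expect_const]
    rw [prob]
    push_cast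
    ring

theorem expect_countP_sq_iid_le (p : PMF α) (N : ℕ) :
    ((p.iid N).expect fun l => (l.countP (· ∈ s) : ℝ≥0∞) ^ 2) ≤
      N * p.prob s + (N * p.prob s) ^ 2 := by
  induction N with
  | zero => simp [iid, expect_pure]
  | succ N ih =>
    have h : ∀ (a : α) (l : List α), (((a :: l).countP (· ∈ s) : ℕ) : ℝ≥0∞) ^ 2 =
        (l.countP (· ∈ s) : ℝ≥0∞) ^ 2 + (2 * s.indicator 1 a) * l.countP (· ∈ s)
          + s.indicator 1 a := by
      intro a l
      by_cases ha : a ∈ s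
      · simp [ha]
        ring
      · simp [ha]
    have e : ∀ a : α, (2 * s.indicator 1 a) * ((N : ℝ≥0∞) * p.prob s) =
        (2 * (N * p.prob s)) * s.indicator 1 a := fun a => by ring
    simp only [iid, expect_bind, expect_map, h, expect_add, expect_const_mul, expect_const,
      expect_countP_iid, e]
    rw [← prob]
    calc _ ≤ N * p.prob s + (N * p.prob s) ^ 2 + 2 * (N * p.prob s) * p.prob s + p.prob s := by
          gcongr
      -- The extra `p²` completes the square `((N + 1) p)²`.
      _ ≤ (N * p.prob s + (N * p.prob s) ^ 2 + 2 * (N * p.prob s) * p.prob s + p.prob s)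
          + p.prob s ^ 2 := le_self_add
      _ = _ := by
          push_cast
          ring

theorem prob_forall_notMem_iid (p : PMF α) (N : ℕ) :
    (p.iid N).prob {l | ∀ x ∈ l, x ∉ s} = p.prob sᶜ ^ N := by
  induction N with
  | zero => simp [iid, prob_pure]
  | succ N ih =>
    simp only [iid, prob_bind, prob_map]
    have h : ∀ a : α, (p.iid N).prob (List.cons a ⁻¹' {l | ∀ x ∈ l, x ∉ s}) =
        p.prob sᶜ ^ N * sᶜ.indicator 1 a := by
      intro a
      rw [← ih]
      by_cases ha : a ∈ s <;> simp [ha, prob, expect, Set.indicator]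
    simp only [h, expect_const_mul]
    rw [← prob, pow_succ]

end PMF

/-! ### Composing algorithms -/

/-- The law `f μ` of a random object that depends on an unknown distribution `μ` can be produced
with exactly `q` conditional samples: it can be used as a subroutine. -/
def IsSampled {n : ℕ} {α : Type} (q : ℕ) (f : PMF (Fin n) → PMF α) : Prop :=
  ∀ (r : ℕ) (next : α → CondAlg n r), ∃ T : CondAlg n (q + r),
    ∀ μ, T.run μ = (f μ).bind fun a => (next a).run μ

namespace IsSampled

variable {n : ℕ} {α β : Type} {q q' : ℕ} {f : PMF (Fin n) → PMF α}

theorem pure (a : α) : IsSampled 0 fun _ : PMF (Fin n) => PMF.pure a := by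
  intro r next
  rw [zero_add]
  exact ⟨next a, fun μ => by simp⟩

theorem bind {g : α → PMF (Fin n) → PMF β} (hf : IsSampled q f)
    (hg : ∀ a, IsSampled q' (g a)) : IsSampled (q + q') fun μ => (f μ).bind fun a => g a μ := by
  intro r next
  choose T hT using fun a => hg a r next
  rw [add_assoc]
  obtain ⟨U, hU⟩ := hf _ T
  exact ⟨U, fun μ => by simp only [hU, hT, PMF.bind_bind]⟩

theorem map (hf : IsSampled q f) (g : α → β) : IsSampled q fun μ => (f μ).map g :=
  hf.bind (q' := 0) fun a => IsSampled.pure (g a)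

theorem condOracle (A : Finset (Fin n)) (hA : A.Nonempty) :
    IsSampled 1 fun μ => condOracle μ A hA := by
  intro r next
  rw [add_comm]
  exact ⟨.query A hA next, fun μ => rfl⟩

theorem iid (hf : IsSampled q f) (N : ℕ) : IsSampled (N * q) fun μ => (f μ).iid N := by
  induction N with
  | zero =>
    rw [zero_mul]
    exact IsSampled.pure []
  | succ N ih =>
    rw [Nat.succ_mul, add_comm]
    exact hf.bind fun a => ih.map (List.cons a)

theorem exists_condAlg {f : PMF (Fin n) → PMF Bool} (hf : IsSampled q f) :
    ∃ T : CondAlg n q, ∀ μ, T.run μ = f μ := by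
  obtain ⟨T, hT⟩ := hf 0 fun b => .output b
  exact ⟨T, fun μ => by rw [hT]; exact PMF.bind_pure _⟩

end IsSampled

/-! ### Estimating the probability of a point with conditional samples -/

section Estimate

variable {n : ℕ}

/-- In product form the identity survives `μ(A) = 0`: both sides vanish, whatever the oracle
answers. -/
theorem sum_mul_prob_condOracle (μ : PMF (Fin n)) (A : Finset (Fin n)) (hA : A.Nonempty)
    {B : Finset (Fin n)} (hB : B ⊆ A) :
    (∑ i ∈ A, μ i) * (condOracle μ A hA).prob (B : Set (Fin n)) = ∑ i ∈ B, μ i := by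
  classical
  by_cases h : ∃ i ∈ (A : Set (Fin n)), i ∈ μ.support
  · have hm : ∑' i, (A : Set (Fin n)).indicator μ i = ∑ i ∈ A, μ i := by
      rw [← PMF.toOuterMeasure_apply, PMF.toOuterMeasure_apply_finset]
    have h0 : ∑ i ∈ A, μ i ≠ 0 := by
      obtain ⟨i, hi, hi'⟩ := h
      intro h0
      exact hi' (Finset.sum_eq_zero_iff.1 h0 i hi)
    have ht : ∑ i ∈ A, μ i ≠ ∞ := by
      simp [PMF.apply_ne_top]
    rw [condOracle, dif_pos h, PMF.prob_finset]
    have : ∀ i ∈ B, μ.filter (A : Set (Fin n)) h i = μ i * (∑ i ∈ A, μ i)⁻¹ := by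
      intro i hi
      rw [PMF.filter_apply, hm, Set.indicator_of_mem (Finset.mem_coe.2 (hB hi))]
    rw [Finset.sum_congr rfl this, ← Finset.sum_mul, mul_left_comm,
      ENNReal.mul_inv_cancel h0 ht, mul_one]
  · push Not at h
    have : ∀ i ∈ A, μ i = 0 := fun i hi => by
      have := h i hi
      rwa [PMF.mem_support_iff, not_not] at this
    rw [Finset.sum_eq_zero this, Finset.sum_eq_zero fun i hi => this i (hB hi), zero_mul]

theorem sum_univ_eq_one (μ : PMF (Fin n)) : ∑ i, μ i = 1 :=
  (tsum_fintype μ).symm.trans μ.tsum_coe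

theorem condOracle_univ (μ : PMF (Fin n)) (h : (Finset.univ : Finset (Fin n)).Nonempty) :
    condOracle μ Finset.univ h = μ := by
  ext i
  have h1 := sum_mul_prob_condOracle μ Finset.univ h (Finset.subset_univ {i})
  rw [sum_univ_eq_one, one_mul, PMF.prob_finset] at h1
  simpa using h1

/-- A subset of `A` that contains half of its elements, rounded down. -/
noncomputable def lowerHalf (A : Finset (Fin n)) : Finset (Fin n) :=
  (Finset.exists_subset_card_eq (Nat.div_le_self A.card 2)).choose

theorem lowerHalf_subset (A : Finset (Fin n)) : lowerHalf A ⊆ A :=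
  (Finset.exists_subset_card_eq (Nat.div_le_self A.card 2)).choose_spec.1

theorem card_lowerHalf (A : Finset (Fin n)) : (lowerHalf A).card = A.card / 2 :=
  (Finset.exists_subset_card_eq (Nat.div_le_self A.card 2)).choose_spec.2

/-- The half of `A` that contains `i`. -/
noncomputable def halfOf (A : Finset (Fin n)) (i : Fin n) : Finset (Fin n) :=
  if i ∈ lowerHalf A then lowerHalf A else A \ lowerHalf A

/-- The law of the estimate of `μ i / μ A` that is the product, over a chain of `d` successive
halvings of `A` towards `i`, of the fractions of the points that lie in the next half among `r`
conditional samples from the present one. -/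
noncomputable def estimate (r : ℕ) (μ : PMF (Fin n)) : ℕ → Finset (Fin n) → Fin n → PMF ℝ≥0∞
  | 0, _, _ => PMF.pure 1
  | d + 1, A, i =>
    ((condOracle μ (insert i A) (Finset.insert_nonempty i A)).iid r).bind fun l =>
      (estimate r μ d (halfOf A i) i).map fun x =>
        (l.countP (· ∈ (halfOf A i : Set (Fin n))) : ℝ≥0∞) * (r : ℝ≥0∞)⁻¹ * x

theorem isSampled_estimate (r d : ℕ) (A : Finset (Fin n)) (i : Fin n) :
    IsSampled (d * r) fun μ => estimate r μ d A i := by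
  induction d generalizing A with
  | zero =>
    rw [zero_mul]
    exact IsSampled.pure 1
  | succ d ih =>
    rw [Nat.succ_mul, add_comm]
    have := ((IsSampled.condOracle (insert i A) (Finset.insert_nonempty i A)).iid r)
    rw [mul_one] at this
    exact this.bind fun l => (ih _).map _

theorem mem_halfOf {A : Finset (Fin n)} {i : Fin n} (hi : i ∈ A) : i ∈ halfOf A i := by
  unfold halfOf
  split_ifs with h
  · exact h
  · exact Finset.mem_sdiff.2 ⟨hi, h⟩

theorem halfOf_subset (A : Finset (Fin n)) (i : Fin n) : halfOf A i ⊆ A := by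
  unfold halfOf
  split_ifs with h
  · exact lowerHalf_subset A
  · exact Finset.sdiff_subset

theorem card_sdiff_lowerHalf (A : Finset (Fin n)) :
    (A \ lowerHalf A).card = A.card - A.card / 2 := by
  rw [Finset.card_sdiff_of_subset (lowerHalf_subset A), card_lowerHalf]

theorem card_halfOf_le {A : Finset (Fin n)} {d : ℕ} (hA : A.card ≤ 2 ^ (d + 1)) (i : Fin n) :
    (halfOf A i).card ≤ 2 ^ d := by
  rw [pow_succ] at hA
  unfold halfOf
  split_ifs with h
  · rw [card_lowerHalf]; omega
  · rw [card_sdiff_lowerHalf]; omega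

theorem sum_ne_top (μ : PMF (Fin n)) (A : Finset (Fin n)) : ∑ i ∈ A, μ i ≠ ∞ := by
  simp [PMF.apply_ne_top]

theorem sum_ne_zero {μ : PMF (Fin n)} {A : Finset (Fin n)} {i : Fin n} (hi : i ∈ A)
    (h : μ i ≠ 0) : ∑ i ∈ A, μ i ≠ 0 := fun h0 => h (Finset.sum_eq_zero_iff.1 h0 i hi)

/-- `estimate` queries `insert i A` only so that the query set is nonempty without a hypothesis;
along the chain `i ∈ A`, and the set is `A` itself. -/
theorem prob_condOracle_insert {μ : PMF (Fin n)} {A B : Finset (Fin n)} {i : Fin n} (hi : i ∈ A)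
    (h : μ i ≠ 0) (hB : B ⊆ A) :
    (condOracle μ (insert i A) (Finset.insert_nonempty i A)).prob (B : Set (Fin n)) =
      (∑ i ∈ B, μ i) * (∑ i ∈ A, μ i)⁻¹ := by
  have h1 := sum_mul_prob_condOracle μ (insert i A) (Finset.insert_nonempty i A)
    (hB.trans (Finset.subset_insert i A))
  have h2 : ∑ j ∈ insert i A, μ j = ∑ j ∈ A, μ j := by rw [Finset.insert_eq_of_mem hi]
  rw [h2] at h1
  rw [← h1, mul_comm, ← mul_assoc, ENNReal.inv_mul_cancel (sum_ne_zero hi h) (sum_ne_top μ A),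
    one_mul]

/-- The estimate is unbiased: the fractions at different levels are independent, each has the true
ratio of masses as its mean, and the ratios telescope. -/
theorem sum_mul_expect_estimate {r : ℕ} (hr : r ≠ 0) (μ : PMF (Fin n)) (d : ℕ)
    (A : Finset (Fin n)) (hA : A.card ≤ 2 ^ d) {i : Fin n} (hi : i ∈ A) (h : μ i ≠ 0) :
    (∑ j ∈ A, μ j) * (estimate r μ d A i).expect id = μ i := by
  induction d generalizing A with
  | zero =>
    have : A = {i} := by
      refine (Finset.eq_of_subset_of_card_le (Finset.singleton_subset_iff.2 hi) ?_).symm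
      simpa using hA
    simp [this, estimate, PMF.expect_pure]
  | succ d ih =>
    have hr' : (r : ℝ≥0∞) ≠ 0 := by exact_mod_cast hr
    have e : ∀ l : List (Fin n), (l.countP (· ∈ (halfOf A i : Set (Fin n))) : ℝ≥0∞) *
        (r : ℝ≥0∞)⁻¹ * (estimate r μ d (halfOf A i) i).expect id =
        ((r : ℝ≥0∞)⁻¹ * (estimate r μ d (halfOf A i) i).expect id) *
          l.countP (· ∈ (halfOf A i : Set (Fin n))) := fun l => by ring
    simp only [estimate, PMF.expect_bind, PMF.expect_map, id]
    change _ * PMF.expect _ (fun l => PMF.expect _ fun a => _ * _ * id a) = _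
    simp only [PMF.expect_const_mul, e]
    rw [PMF.expect_countP_iid, prob_condOracle_insert hi h (halfOf_subset A i),
      ← ih (halfOf A i) (card_halfOf_le hA i) (mem_halfOf hi)]
    calc _ = ((r : ℝ≥0∞) * (r : ℝ≥0∞)⁻¹) * ((∑ j ∈ A, μ j) * (∑ j ∈ A, μ j)⁻¹) *
          ((∑ i ∈ halfOf A i, μ i) * (estimate r μ d (halfOf A i) i).expect id) := by ring
      _ = _ := by
        rw [ENNReal.mul_inv_cancel hr' (ENNReal.natCast_ne_top r),
          ENNReal.mul_inv_cancel (sum_ne_zero hi h) (sum_ne_top μ A), one_mul, one_mul]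

/-- With `p` the conditional probability of the next half, the second moment of the fraction found
is at most `p / r + p²`; independence multiplies it with that of the rest of the chain. -/
theorem expect_estimate_sq_succ_le {r : ℕ} (hr : r ≠ 0) (μ : PMF (Fin n)) (d : ℕ)
    (A : Finset (Fin n)) {i : Fin n} (hi : i ∈ A) (h : μ i ≠ 0) :
    (estimate r μ (d + 1) A i).expect (fun x => x ^ 2) ≤
      (∑ j ∈ halfOf A i, μ j) * (∑ j ∈ A, μ j)⁻¹ *
        ((r : ℝ≥0∞)⁻¹ + (∑ j ∈ halfOf A i, μ j) * (∑ j ∈ A, μ j)⁻¹) *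
          (estimate r μ d (halfOf A i) i).expect (fun x => x ^ 2) := by
  have hr' : (r : ℝ≥0∞) ≠ 0 := by exact_mod_cast hr
  set Q := (estimate r μ d (halfOf A i) i).expect (fun x => x ^ 2) with hQ
  set p := (∑ j ∈ halfOf A i, μ j) * (∑ j ∈ A, μ j)⁻¹ with hp
  have e : ∀ l : List (Fin n), (estimate r μ d (halfOf A i) i).expect (fun x =>
      ((l.countP (· ∈ (halfOf A i : Set (Fin n))) : ℝ≥0∞) * (r : ℝ≥0∞)⁻¹ * x) ^ 2) =
        ((r : ℝ≥0∞)⁻¹ ^ 2 * Q) * (l.countP (· ∈ (halfOf A i : Set (Fin n))) : ℝ≥0∞) ^ 2 := fun l => by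
    rw [hQ, mul_right_comm, ← PMF.expect_const_mul]
    congr 1
    funext x
    ring
  simp only [estimate, PMF.expect_bind, PMF.expect_map, e, PMF.expect_const_mul]
  refine (mul_le_mul_right (PMF.expect_countP_sq_iid_le _ _ _) _).trans_eq ?_
  rw [prob_condOracle_insert hi h (halfOf_subset A i), ← hp]
  calc _ = ((r : ℝ≥0∞) * (r : ℝ≥0∞)⁻¹) * (p * ((r : ℝ≥0∞)⁻¹ +
        ((r : ℝ≥0∞) * (r : ℝ≥0∞)⁻¹) * p) * Q) := by ring
    _ = _ := by
      rw [ENNReal.mul_inv_cancel hr' (ENNReal.natCast_ne_top r), one_mul, one_mul]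

/-- The second moments of the relative estimates in `A`, weighted by `μ`, add up to at most
`(1 + 2 / r) ^ d`. -/
theorem sum_mul_sum_expect_estimate_sq_le {r : ℕ} (hr : r ≠ 0) (μ : PMF (Fin n)) (d : ℕ)
    (A : Finset (Fin n)) (hA : A.card ≤ 2 ^ d) :
    (∑ j ∈ A, μ j) * ∑ i ∈ A with μ i ≠ 0,
      (μ i)⁻¹ * (estimate r μ d A i).expect (fun x => x ^ 2) ≤
        (1 + 2 * (r : ℝ≥0∞)⁻¹) ^ d := by
  classical
  induction d generalizing A with
  | zero =>
    rw [pow_zero] at hA ⊢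
    rcases Nat.le_one_iff_eq_zero_or_eq_one.1 hA with h | h
    · simp [Finset.card_eq_zero.1 h]
    · obtain ⟨i, rfl⟩ := Finset.card_eq_one.1 h
      by_cases h : μ i = 0
      · simp [h, Finset.filter_singleton]
      · simp [h, Finset.filter_singleton, estimate, PMF.expect_pure,
          ENNReal.mul_inv_cancel h (μ.apply_ne_top i)]
  | succ d ih =>
    by_cases h0 : ∑ j ∈ A, μ j = 0
    · rw [h0, zero_mul]
      exact zero_le
    -- The share of one half `B`. Of the factor `p (1/r + p)` with `p = μ(B)/μ(A)`, the first `p`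
    -- turns the weight `μ(A)` into the `μ(B)` of the induction hypothesis. What remains, `1/r + p`,
    -- adds up to `2/r + 1` over the two halves.
    have hle : ∀ B ⊆ A, B.card ≤ 2 ^ d → (∀ i ∈ B, halfOf A i = B) →
        (∑ j ∈ A, μ j) * ∑ i ∈ B with μ i ≠ 0,
          (μ i)⁻¹ * (estimate r μ (d + 1) A i).expect (fun x => x ^ 2) ≤
          ((r : ℝ≥0∞)⁻¹ + (∑ j ∈ B, μ j) * (∑ j ∈ A, μ j)⁻¹) *
            (1 + 2 * (r : ℝ≥0∞)⁻¹) ^ d := by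
      intro B hBA hB hh
      have h1 : ∑ i ∈ B with μ i ≠ 0,
          (μ i)⁻¹ * (estimate r μ (d + 1) A i).expect (fun x => x ^ 2) ≤
          ∑ i ∈ B with μ i ≠ 0, ((∑ j ∈ B, μ j) * (∑ j ∈ A, μ j)⁻¹ *
            ((r : ℝ≥0∞)⁻¹ + (∑ j ∈ B, μ j) * (∑ j ∈ A, μ j)⁻¹)) *
            ((μ i)⁻¹ * (estimate r μ d B i).expect (fun x => x ^ 2)) := by
        refine Finset.sum_le_sum fun i hi => ?_
        rw [Finset.mem_filter] at hi
        have h2 := expect_estimate_sq_succ_le hr μ d A (hBA hi.1) hi.2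
        rw [hh i hi.1] at h2
        refine (mul_le_mul_right h2 _).trans_eq ?_
        ring
      rw [← Finset.mul_sum] at h1
      refine (mul_le_mul_right h1 _).trans ?_
      calc _ = ((∑ j ∈ A, μ j) * (∑ j ∈ A, μ j)⁻¹) *
            ((r : ℝ≥0∞)⁻¹ + (∑ j ∈ B, μ j) * (∑ j ∈ A, μ j)⁻¹) *
            ((∑ j ∈ B, μ j) * ∑ i ∈ B with μ i ≠ 0,
              (μ i)⁻¹ * (estimate r μ d B i).expect (fun x => x ^ 2)) := by ring
        _ ≤ _ := by
          rw [ENNReal.mul_inv_cancel h0 (sum_ne_top μ A), one_mul]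
          exact mul_le_mul_right (ih B hB) _
    have hA' : A.card ≤ 2 ^ d * 2 := by rwa [← pow_succ]
    have hL := hle (lowerHalf A) (lowerHalf_subset A) (by rw [card_lowerHalf]; omega)
      fun i hi => if_pos hi
    have hU := hle (A \ lowerHalf A) Finset.sdiff_subset (by rw [card_sdiff_lowerHalf]; omega)
      fun i hi => if_neg (Finset.mem_sdiff.1 hi).2
    have hs : ∀ f : Fin n → ℝ≥0∞, ∑ i ∈ A with μ i ≠ 0, f i =
        (∑ i ∈ A \ lowerHalf A with μ i ≠ 0, f i) + ∑ i ∈ lowerHalf A with μ i ≠ 0, f i := by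
      intro f
      simp only [Finset.sum_filter]
      exact (Finset.sum_sdiff (lowerHalf_subset A)).symm
    rw [hs, mul_add]
    refine (add_le_add hU hL).trans_eq ?_
    rw [← add_mul, pow_succ, mul_comm]
    congr 1
    calc _ = 2 * (r : ℝ≥0∞)⁻¹ + ((∑ j ∈ A \ lowerHalf A, μ j) + ∑ j ∈ lowerHalf A, μ j) *
          (∑ j ∈ A, μ j)⁻¹ := by ring
      _ = _ := by
        rw [Finset.sum_sdiff (lowerHalf_subset A), ENNReal.mul_inv_cancel h0 (sum_ne_top μ A),
          add_comm]

/-- The law of a random point of `μ` together with the estimate of its probability. -/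
noncomputable def pointEstimate (r L : ℕ) (μ : PMF (Fin n)) : PMF (Fin n × ℝ≥0∞) :=
  μ.bind fun i => (estimate r μ L Finset.univ i).map fun x => (i, x)

theorem isSampled_id (hn : n ≠ 0) : IsSampled 1 fun μ : PMF (Fin n) => μ := by
  have h : (Finset.univ : Finset (Fin n)).Nonempty := ⟨⟨0, Nat.pos_of_ne_zero hn⟩, by simp⟩
  simpa only [condOracle_univ] using IsSampled.condOracle Finset.univ h

theorem isSampled_pointEstimate (hn : n ≠ 0) (r L : ℕ) :
    IsSampled (1 + L * r) (pointEstimate (n := n) r L) :=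
  (isSampled_id hn).bind fun i => (isSampled_estimate r L Finset.univ i).map _

theorem map_fst_pointEstimate (r L : ℕ) (μ : PMF (Fin n)) :
    (pointEstimate r L μ).map Prod.fst = μ := by
  unfold pointEstimate
  simp only [PMF.map_bind, PMF.map_comp, Function.comp_def]
  have : ∀ i, PMF.map (fun _ : ℝ≥0∞ => i) (estimate r μ L Finset.univ i) = PMF.pure i :=
    fun i => PMF.map_const _ i
  simp only [this, PMF.bind_pure]

/-- This is `τ² ≤ (y - 1)²` for `y = x / m`, written without subtraction. -/
theorem sq_add_two_mul_le {τ m : ℝ} (hτ : 0 ≤ τ) (hm : 0 < m) {x : ℝ≥0∞}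
    (h : τ * m < |x.toReal - m|) :
    ENNReal.ofReal (τ ^ 2) + 2 * (x * (ENNReal.ofReal m)⁻¹) ≤
      (x * (ENNReal.ofReal m)⁻¹) ^ 2 + 1 := by
  have hm' : ENNReal.ofReal m ≠ 0 := by simpa using hm
  induction x with
  | top => simp
  | coe x =>
    have hy : (x : ℝ≥0∞) * (ENNReal.ofReal m)⁻¹ = ENNReal.ofReal (x / m) := by
      rw [ENNReal.ofReal_div_of_pos hm, ENNReal.ofReal_coe_nnreal, div_eq_mul_inv]
    have hx : (0 : ℝ) ≤ x / m := by positivity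
    rw [hy, ← ENNReal.ofReal_pow hx, ← ENNReal.ofReal_one, ← ENNReal.ofReal_add (by positivity)
      (by norm_num), show (2 : ℝ≥0∞) = ENNReal.ofReal 2 by simp,
      ← ENNReal.ofReal_mul (by norm_num), ← ENNReal.ofReal_add (by positivity) (by positivity)]
    refine ENNReal.ofReal_le_ofReal ?_
    have h1 : τ < |x / m - 1| := by
      rw [ENNReal.coe_toReal] at h
      have : (x : ℝ) / m - 1 = (x - m) / m := by field_simp
      rw [this, abs_div, abs_of_pos hm, lt_div_iff₀ hm]
      exact h
    have h2 : τ ^ 2 ≤ (x / m - 1) ^ 2 := by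
      rw [← sq_abs (x / m - 1 : ℝ)]
      gcongr
    nlinarith

theorem two_mul_le_sq_add_one (x : ℝ≥0∞) : 2 * x ≤ x ^ 2 + 1 := by
  induction x with
  | top => simp
  | coe x =>
    norm_cast
    have := two_mul_le_add_sq (x : ℝ) 1
    rw [← NNReal.coe_le_coe]
    push_cast
    linarith

/-- Chebyshev's inequality averaged over the random point: the mean relative second moment is at
most `1 + κ`, so the mean relative variance is at most `κ`. No bound for an individual point is
claimed. -/
theorem prob_pointEstimate_le {r L : ℕ} (hr : r ≠ 0) (hn : n ≤ 2 ^ L) (μ : PMF (Fin n)) {τ : ℝ}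
    (hτ : 0 ≤ τ) {κ : ℝ≥0∞} (hκ : (1 + 2 * (r : ℝ≥0∞)⁻¹) ^ L ≤ 1 + κ) :
    ENNReal.ofReal (τ ^ 2) * (pointEstimate r L μ).prob
      {z | τ * (μ z.1).toReal < |z.2.toReal - (μ z.1).toReal|} ≤ κ := by
  classical
  set P : Fin n → ℝ≥0∞ := fun i => (estimate r μ L Finset.univ i).prob
    {x | τ * (μ i).toReal < |x.toReal - (μ i).toReal|} with hP
  set Q : Fin n → ℝ≥0∞ := fun i => (estimate r μ L Finset.univ i).expect (fun x => x ^ 2) with hQ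
  have hmass := sum_univ_eq_one μ
  have hcard : (Finset.univ : Finset (Fin n)).card ≤ 2 ^ L := by simpa using hn
  have hpt : ∀ i, μ i ≠ 0 → ENNReal.ofReal (τ ^ 2) * P i + 2 ≤ (μ i)⁻¹ ^ 2 * Q i + 1 := by
    intro i hi
    have hmean := sum_mul_expect_estimate hr μ L Finset.univ hcard (Finset.mem_univ i) hi
    rw [hmass, one_mul] at hmean
    have hmean' : (estimate r μ L Finset.univ i).expect (fun x => 2 * (x * (μ i)⁻¹)) = 2 := by
      have : ∀ x : ℝ≥0∞, 2 * (x * (μ i)⁻¹) = (2 * (μ i)⁻¹) * id x := fun x => by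
        simp only [id]; ring
      simp only [this, PMF.expect_const_mul]
      rw [hmean, mul_assoc, ENNReal.inv_mul_cancel hi (μ.apply_ne_top i), mul_one]
    have hsq : (estimate r μ L Finset.univ i).expect (fun x => (x * (μ i)⁻¹) ^ 2 + 1) =
        (μ i)⁻¹ ^ 2 * Q i + 1 := by
      have : ∀ x : ℝ≥0∞, (x * (μ i)⁻¹) ^ 2 = (μ i)⁻¹ ^ 2 * x ^ 2 := fun x => by ring
      simp only [this, PMF.expect_const_mul, PMF.expect_add, PMF.expect_const, hQ]
    rw [← hsq]
    simp only [hP, PMF.prob]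
    rw [← hmean', ← PMF.expect_const_mul, ← PMF.expect_add]
    refine PMF.expect_mono _ fun x => ?_
    have hpos : 0 < (μ i).toReal := ENNReal.toReal_pos hi (μ.apply_ne_top i)
    by_cases hx : τ * (μ i).toReal < |x.toReal - (μ i).toReal|
    · have := sq_add_two_mul_le hτ hpos hx
      rw [ENNReal.ofReal_toReal (μ.apply_ne_top i)] at this
      simpa [hx] using this
    · simpa [hx] using two_mul_le_sq_add_one (x * (μ i)⁻¹)
  have hprob : (pointEstimate r L μ).prob
      {z | τ * (μ z.1).toReal < |z.2.toReal - (μ z.1).toReal|} = μ.expect P := by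
    simp only [pointEstimate, PMF.prob_bind, PMF.prob_map]
    rfl
  have hsecond : μ.expect (fun i => (μ i)⁻¹ ^ 2 * Q i * if μ i = 0 then 0 else 1) ≤ 1 + κ := by
    refine le_trans ?_ hκ
    have := sum_mul_sum_expect_estimate_sq_le hr μ L Finset.univ hcard
    rw [hmass, one_mul] at this
    refine le_trans (le_of_eq ?_) this
    rw [PMF.expect_fintype, Finset.sum_filter]
    refine Finset.sum_congr rfl fun i _ => ?_
    by_cases hi : μ i = 0
    · simp [hi]
    · rw [if_neg hi, if_pos hi, mul_one, pow_two, ← mul_assoc, ← mul_assoc,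
        ENNReal.mul_inv_cancel hi (μ.apply_ne_top i), one_mul]
  rw [hprob, ← PMF.expect_const_mul]
  have h1 : (μ.expect fun i => ENNReal.ofReal (τ ^ 2) * P i) + 2 ≤ (1 + κ) + 1 := by
    calc _ = μ.expect fun i => ENNReal.ofReal (τ ^ 2) * P i + 2 := by
          rw [PMF.expect_add, PMF.expect_const]
      _ ≤ μ.expect fun i => (μ i)⁻¹ ^ 2 * Q i * (if μ i = 0 then 0 else 1) + 1 := by
          refine PMF.expect_mono_of_ne_zero _ fun i hi => ?_
          rw [if_neg hi, mul_one]
          exact hpt i hi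
      _ ≤ _ := by
          rw [PMF.expect_add, PMF.expect_const]
          gcongr
  have h2 : (1 + κ) + 1 = κ + 2 := by
    rw [add_comm 1 κ, add_assoc, one_add_one_eq_two]
  rw [h2] at h1
  exact (ENNReal.add_le_add_iff_right (by simp)).1 h1

end Estimate

/-! ### From couplings to permutations -/

section Matching

variable {ι κ : Type*} [Fintype ι]

/-- By Birkhoff's theorem the cost of `M` is an average of costs of permutations. One that occurs
with positive weight costs at most the average, and positive weight confines it to the support of
`M`, hence to the blocks. -/
theorem exists_perm_cost_le_of_doublyStochastic [DecidableEq ι] {M : Matrix ι ι ℝ}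
    (hM : M ∈ doublyStochastic ℝ ι) (c : ι → ι → ℝ) (g : ι → κ)
    (hg : ∀ i j, M i j ≠ 0 → g i = g j) :
    ∃ σ : Equiv.Perm ι, (∀ i, g (σ i) = g i) ∧ ∑ i, c i (σ i) ≤ ∑ i, ∑ j, M i j * c i j := by
  obtain ⟨w, hw0, hw1, hwM⟩ := exists_eq_sum_perm_of_mem_doublyStochastic hM
  have hent : ∀ i j, M i j = ∑ σ : Equiv.Perm ι, w σ * if σ i = j then 1 else 0 := by
    intro i j
    rw [← hwM]
    simp [Matrix.sum_apply, Equiv.Perm.permMatrix, PEquiv.toMatrix_apply, eq_comm]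
  have hcost : ∑ i, ∑ j, M i j * c i j = ∑ σ : Equiv.Perm ι, w σ * ∑ i, c i (σ i) := by
    simp only [hent, Finset.sum_mul, Finset.mul_sum]
    have : ∀ i, ∑ j, ∑ σ : Equiv.Perm ι, (w σ * if σ i = j then 1 else 0) * c i j =
        ∑ σ : Equiv.Perm ι, w σ * c i (σ i) := by
      intro i
      rw [Finset.sum_comm]
      refine Finset.sum_congr rfl fun σ _ => ?_
      simp
    simp only [this]
    exact Finset.sum_comm
  have hne : (Finset.univ.filter fun σ => w σ ≠ 0).Nonempty := by
    by_contra h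
    rw [Finset.not_nonempty_iff_eq_empty, Finset.filter_eq_empty_iff] at h
    have : ∑ σ, w σ = 0 := Finset.sum_eq_zero fun σ hσ => by simpa using h hσ
    rw [this] at hw1
    exact zero_ne_one hw1
  have hle : ∑ σ with w σ ≠ 0, w σ * ∑ i, c i (σ i) ≤
      ∑ σ with w σ ≠ 0, w σ * ∑ i, ∑ j, M i j * c i j := by
    rw [← Finset.sum_mul, Finset.sum_filter_of_ne fun σ _ h => h, hw1, one_mul, hcost,
      Finset.sum_filter_of_ne fun σ _ h => left_ne_zero_of_mul h]
  obtain ⟨σ, hσ, hσc⟩ := Finset.exists_le_of_sum_le hne hle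
  have hwσ : 0 < w σ := lt_of_le_of_ne (hw0 σ) (Ne.symm (Finset.mem_filter.1 hσ).2)
  refine ⟨σ, fun i => (hg i (σ i) ?_).symm, le_of_mul_le_mul_left hσc hwσ⟩
  rw [hent]
  refine ne_of_gt (lt_of_lt_of_le hwσ ?_)
  refine le_trans (by simp) (Finset.single_le_sum (f := fun τ : Equiv.Perm ι =>
    w τ * if τ i = σ i then 1 else 0) (fun τ _ => ?_) (Finset.mem_univ σ))
  exact mul_nonneg (hw0 τ) (by split_ifs <;> norm_num)

/-- A substochastic matrix that is supported on a block structure can be completed within the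
blocks to a doubly stochastic one. -/
theorem exists_completion_doublyStochastic [DecidableEq ι] (D : ι → ι → ℝ) (g : ι → κ)
    (hr : ∀ i, ∑ j, D i j ≤ 1) (hc : ∀ j, ∑ i, D i j ≤ 1)
    (hg : ∀ i j, D i j ≠ 0 → g i = g j) :
    ∃ E : ι → ι → ℝ, (∀ i j, 0 ≤ E i j) ∧ (∀ i j, E i j ≠ 0 → g i = g j) ∧
      (∀ i, ∑ j, E i j = 1 - ∑ j, D i j) ∧ (∀ j, ∑ i, E i j = 1 - ∑ i, D i j) := by
  classical
  set u : ι → ℝ := fun i => 1 - ∑ j, D i j with hu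
  set v : ι → ℝ := fun j => 1 - ∑ i, D i j with hv
  have hu0 : ∀ i, 0 ≤ u i := fun i => sub_nonneg.2 (hr i)
  have hv0 : ∀ i, 0 ≤ v i := fun i => sub_nonneg.2 (hc i)
  set T : κ → ℝ := fun k => ∑ i with g i = k, u i with hT
  have hT' : ∀ k, T k = ∑ j with g j = k, v j := by
    intro k
    simp only [hT, hu, hv, Finset.sum_sub_distrib]
    congr 1
    have h1 : ∀ i ∈ Finset.univ.filter (fun i => g i = k),
        ∑ j, D i j = ∑ j with g j = k, D i j := by
      intro i hi
      refine (Finset.sum_filter_of_ne fun j _ h => ?_).symm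
      rw [← hg i j h]
      exact (Finset.mem_filter.1 hi).2
    have h2 : ∀ j ∈ Finset.univ.filter (fun j => g j = k),
        ∑ i, D i j = ∑ i with g i = k, D i j := by
      intro j hj
      refine (Finset.sum_filter_of_ne fun i _ h => ?_).symm
      rw [hg i j h]
      exact (Finset.mem_filter.1 hj).2
    rw [Finset.sum_congr rfl h1, Finset.sum_congr rfl h2, Finset.sum_comm]
  have hT0 : ∀ k, 0 ≤ T k := fun k => Finset.sum_nonneg fun i _ => hu0 i
  -- In each block the row deficits `u` and the column deficits `v` have the same total `T`, because
  -- `D` does not leave the blocks; a rank-one matrix fills them. Where `T = 0` all deficits vanish,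
  -- so division by zero does no harm.
  refine ⟨fun i j => if g i = g j then u i * v j / T (g i) else 0, fun i j => ?_, fun i j => ?_,
    fun i => ?_, fun j => ?_⟩
  · dsimp only
    split_ifs
    · exact div_nonneg (mul_nonneg (hu0 i) (hv0 j)) (hT0 _)
    · exact le_rfl
  · intro h
    by_contra h'
    exact h (if_neg h')
  · rw [← Finset.sum_filter, ← Finset.sum_div, ← Finset.mul_sum]
    have : ∑ j with g i = g j, v j = T (g i) := by
      rw [hT']
      exact Finset.sum_congr (by ext j; simp [eq_comm]) fun _ _ => rfl
    rw [this]
    by_cases h : T (g i) = 0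
    · have : u i = 0 := (Finset.sum_eq_zero_iff_of_nonneg fun i _ => hu0 i).1 h i (by simp)
      rw [this, zero_mul, zero_div]
      exact this.symm
    · exact mul_div_cancel_right₀ _ h
  · have : ∀ i, (if g i = g j then u i * v j / T (g i) else 0) =
        if g i = g j then u i * (v j / T (g j)) else 0 := by
      intro i
      split_ifs with h
      · rw [h, mul_div_assoc]
      · rfl
    simp only [this]
    rw [← Finset.sum_filter, ← Finset.sum_mul]
    change T (g j) * _ = _
    by_cases h : T (g j) = 0
    · rw [h, zero_mul]
      rw [hT'] at h
      exact ((Finset.sum_eq_zero_iff_of_nonneg fun i _ => hv0 i).1 h j (by simp)).symm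
    · exact mul_div_cancel₀ _ h

/-- If a partial coupling of two distributions is supported on pairs of points of the same block
and of almost equal weight, then a permutation that preserves the blocks takes one distribution
close to the other. -/
theorem exists_perm_of_subcoupling {a b : ι → ℝ} (ha0 : ∀ i, 0 ≤ a i) (hb0 : ∀ i, 0 ≤ b i)
    (ha1 : ∑ i, a i = 1) (hb1 : ∑ i, b i = 1) (W : ι → ι → ℝ) (g : ι → κ) {t Δ : ℝ} (ht : 0 ≤ t)
    (h0 : ∀ i j, 0 ≤ W i j) (hr : ∀ i, ∑ j, W i j ≤ a i) (hc : ∀ j, ∑ i, W i j ≤ b j)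
    (hg : ∀ i j, W i j ≠ 0 → g i = g j ∧ |a i - b j| ≤ t * max (a i) (b j))
    (hΔ : 1 - Δ ≤ ∑ i, ∑ j, W i j) :
    ∃ σ : Equiv.Perm ι, (∀ i, g (σ i) = g i) ∧ ∑ i, |a i - b (σ i)| ≤ 2 * Δ + 3 * t := by
  classical
  have hWa : ∀ i j, W i j ≤ a i := fun i j =>
    (Finset.single_le_sum (fun j _ => h0 i j) (Finset.mem_univ j)).trans (hr i)
  have hWb : ∀ i j, W i j ≤ b j := fun i j =>
    (Finset.single_le_sum (f := fun i => W i j) (fun i _ => h0 i j) (Finset.mem_univ i)).trans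
      (hc j)
  have hW1 : ∑ i, ∑ j, W i j ≤ 1 := ha1 ▸ Finset.sum_le_sum fun i _ => hr i
  set m : ι → ι → ℝ := fun i j => max (a i) (b j) with hm
  have hm0 : ∀ i j, 0 ≤ m i j := fun i j => le_max_of_le_left (ha0 i)
  -- Dividing by the larger of the two weights turns transported mass into fractions of points, with
  -- both row and column sums at most `1`.
  set D : ι → ι → ℝ := fun i j => W i j / m i j with hD
  have hD0 : ∀ i j, 0 ≤ D i j := fun i j => div_nonneg (h0 i j) (hm0 i j)
  have hWD : ∀ i j, W i j = D i j * m i j := by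
    intro i j
    by_cases h : m i j = 0
    · have h1 : a i ≤ 0 := h ▸ le_max_left _ _
      rw [h, mul_zero]
      exact le_antisymm ((hWa i j).trans h1) (h0 i j)
    · exact (div_mul_cancel₀ _ h).symm
  have hDW : ∀ i j, D i j ≠ 0 → W i j ≠ 0 := fun i j h h' => h (by simp [hD, h'])
  have hDr : ∀ i, ∑ j, D i j ≤ 1 := by
    intro i
    rcases (ha0 i).eq_or_lt with h | h
    · refine (Finset.sum_nonpos fun j _ => le_of_eq ?_).trans zero_le_one
      have : W i j = 0 := le_antisymm (h ▸ hWa i j) (h0 i j)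
      simp [hD, this]
    · refine le_of_mul_le_mul_right ?_ h
      rw [one_mul, Finset.sum_mul]
      refine (Finset.sum_le_sum fun j _ => ?_).trans (hr i)
      rw [hWD]
      exact mul_le_mul_of_nonneg_left (le_max_left _ _) (hD0 i j)
  have hDc : ∀ j, ∑ i, D i j ≤ 1 := by
    intro j
    rcases (hb0 j).eq_or_lt with h | h
    · refine (Finset.sum_nonpos fun i _ => le_of_eq ?_).trans zero_le_one
      have : W i j = 0 := le_antisymm (h ▸ hWb i j) (h0 i j)
      simp [hD, this]
    · refine le_of_mul_le_mul_right ?_ h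
      rw [one_mul, Finset.sum_mul]
      refine (Finset.sum_le_sum fun i _ => ?_).trans (hc j)
      rw [hWD]
      exact mul_le_mul_of_nonneg_left (le_max_right _ _) (hD0 i j)
  obtain ⟨E, hE0, hEg, hEr, hEc⟩ := exists_completion_doublyStochastic D g hDr hDc
    fun i j h => (hg i j (hDW i j h)).1
  have hM : (Matrix.of fun i j => D i j + E i j) ∈ doublyStochastic ℝ ι := by
    rw [mem_doublyStochastic_iff_sum]
    refine ⟨fun i j => add_nonneg (hD0 i j) (hE0 i j), fun i => ?_, fun j => ?_⟩
    · simp [Finset.sum_add_distrib, hEr]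
    · simp [Finset.sum_add_distrib, hEc]
  obtain ⟨σ, hσ, hcost⟩ := exists_perm_cost_le_of_doublyStochastic hM (fun i j => |a i - b j|) g
    fun i j h => by
      by_cases hd : D i j = 0
      · refine hEg i j fun he => h ?_
        simp [hd, he]
      · exact (hg i j (hDW i j hd)).1
  refine ⟨σ, hσ, hcost.trans ?_⟩
  have hclose : ∀ i j, D i j * |a i - b j| ≤ t * W i j := by
    intro i j
    by_cases h : D i j = 0
    · rw [h, zero_mul]
      exact mul_nonneg ht (h0 i j)
    · rw [hWD i j, mul_left_comm]
      exact mul_le_mul_of_nonneg_left (hg i j (hDW i j h)).2 (hD0 i j)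
  have hDa : ∀ i j, W i j - t * W i j ≤ D i j * a i := by
    intro i j
    have h1 := hclose i j
    have h2 : D i j * m i j ≤ D i j * (a i + |a i - b j|) := by
      refine mul_le_mul_of_nonneg_left (max_le ?_ ?_) (hD0 i j)
      · linarith [abs_nonneg (a i - b j)]
      · linarith [neg_abs_le (a i - b j)]
    rw [← hWD, mul_add] at h2
    linarith
  have hDb : ∀ i j, W i j - t * W i j ≤ D i j * b j := by
    intro i j
    have h1 := hclose i j
    have h2 : D i j * m i j ≤ D i j * (b j + |a i - b j|) := by
      refine mul_le_mul_of_nonneg_left (max_le ?_ ?_) (hD0 i j)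
      · linarith [le_abs_self (a i - b j)]
      · linarith [abs_nonneg (a i - b j)]
    rw [← hWD, mul_add] at h2
    linarith
  have hS : ∑ i, ∑ j, (W i j - t * W i j) = (1 - t) * ∑ i, ∑ j, W i j := by
    simp only [Finset.mul_sum]
    exact Finset.sum_congr rfl fun i _ => Finset.sum_congr rfl fun j _ => by ring
  have h1 : ∑ i, ∑ j, E i j * a i ≤ 1 - (1 - t) * ∑ i, ∑ j, W i j := by
    have : ∀ i, ∑ j, E i j * a i = a i - ∑ j, D i j * a i := by
      intro i
      rw [← Finset.sum_mul, hEr, ← Finset.sum_mul]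
      ring
    simp only [this, Finset.sum_sub_distrib, ha1]
    have := Finset.sum_le_sum fun i (_ : i ∈ Finset.univ) =>
      Finset.sum_le_sum fun j (_ : j ∈ Finset.univ) => hDa i j
    linarith
  have h2 : ∑ i, ∑ j, E i j * b j ≤ 1 - (1 - t) * ∑ i, ∑ j, W i j := by
    rw [Finset.sum_comm]
    have : ∀ j, ∑ i, E i j * b j = b j - ∑ i, D i j * b j := by
      intro j
      rw [← Finset.sum_mul, hEc, ← Finset.sum_mul]
      ring
    simp only [this, Finset.sum_sub_distrib, hb1]
    have := Finset.sum_le_sum fun i (_ : i ∈ Finset.univ) =>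
      Finset.sum_le_sum fun j (_ : j ∈ Finset.univ) => hDb i j
    rw [hS] at this
    rw [Finset.sum_comm (f := fun j i => D i j * b j)]
    linarith
  have h3 : ∑ i, ∑ j, (Matrix.of fun i j => D i j + E i j) i j * |a i - b j| ≤
      ∑ i, ∑ j, (t * W i j + (E i j * a i + E i j * b j)) := by
    refine Finset.sum_le_sum fun i _ => Finset.sum_le_sum fun j _ => ?_
    rw [Matrix.of_apply, add_mul, ← mul_add]
    refine add_le_add (hclose i j) (mul_le_mul_of_nonneg_left ?_ (hE0 i j))
    rw [abs_le]
    constructor <;> linarith [ha0 i, hb0 j]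
  -- With `w` the total mass of `W`, the cost is at most `t w + 2 (1 - (1 - t) w) = 2 (1 - w) + 3 t
  -- w`.
  refine h3.trans ?_
  simp only [Finset.sum_add_distrib, ← Finset.mul_sum]
  have h4 : t * ∑ i, ∑ j, W i j ≤ t := by
    simpa using mul_le_mul_of_nonneg_left hW1 ht
  nlinarith

variable {lab : Type*} [Fintype lab]

/-- Points of two distributions that carry the same random label can be coupled; a block-preserving
permutation results if equally labelled points belong together. -/
theorem exists_perm_of_labels {a b : ι → ℝ} (ha0 : ∀ i, 0 ≤ a i) (hb0 : ∀ i, 0 ≤ b i)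
    (ha1 : ∑ i, a i = 1) (hb1 : ∑ i, b i = 1) (R R' : ι → lab → ℝ) (g : ι → κ) {t Δ : ℝ}
    (ht : 0 ≤ t) (hR0 : ∀ i x, 0 ≤ R i x) (hR0' : ∀ i x, 0 ≤ R' i x)
    (hRa : ∀ i, ∑ x, R i x ≤ a i) (hRb : ∀ i, ∑ x, R' i x ≤ b i)
    (hg : ∀ i j x, R i x ≠ 0 → R' j x ≠ 0 → g i = g j ∧ |a i - b j| ≤ t * max (a i) (b j))
    (hΔ : 1 - Δ ≤ ∑ x, min (∑ i, R i x) (∑ i, R' i x)) :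
    ∃ σ : Equiv.Perm ι, (∀ i, g (σ i) = g i) ∧ ∑ i, |a i - b (σ i)| ≤ 2 * Δ + 3 * t := by
  set F : lab → ℝ := fun x => ∑ i, R i x with hF
  set F' : lab → ℝ := fun x => ∑ i, R' i x with hF'
  have hF0 : ∀ x, 0 ≤ F x := fun x => Finset.sum_nonneg fun i _ => hR0 i x
  have hF0' : ∀ x, 0 ≤ F' x := fun x => Finset.sum_nonneg fun i _ => hR0' i x
  -- On each label the two conditional laws are coupled independently, scaled to the common mass
  -- `min (F x) (F' x)`.
  set K : lab → ℝ := fun x => min (F x) (F' x) / (F x * F' x) with hK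
  have hK0 : ∀ x, 0 ≤ K x := fun x =>
    div_nonneg (le_min (hF0 x) (hF0' x)) (mul_nonneg (hF0 x) (hF0' x))
  have hK1 : ∀ x, F x * F' x * K x = min (F x) (F' x) := by
    intro x
    by_cases h : F x * F' x = 0
    · rw [h, zero_mul]
      rcases mul_eq_zero.1 h with h | h
      · rw [h, min_eq_left (hF0' x)]
      · rw [h, min_eq_right (hF0 x)]
    · exact mul_div_cancel₀ _ h
  have hKF : ∀ x, F x * K x ≤ 1 := by
    intro x
    by_cases h : F' x = 0
    · simp [hK, h]
    · have h' : 0 < F' x := lt_of_le_of_ne (hF0' x) (Ne.symm h)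
      refine le_of_mul_le_mul_right ?_ h'
      rw [one_mul, mul_right_comm, hK1]
      exact min_le_right _ _
  have hKF' : ∀ x, F' x * K x ≤ 1 := by
    intro x
    by_cases h : F x = 0
    · simp [hK, h]
    · have h' : 0 < F x := lt_of_le_of_ne (hF0 x) (Ne.symm h)
      refine le_of_mul_le_mul_left ?_ h'
      rw [mul_one, ← mul_assoc, hK1]
      exact min_le_left _ _
  refine exists_perm_of_subcoupling ha0 hb0 ha1 hb1 (fun i j => ∑ x, R i x * R' j x * K x) g ht
    (fun i j => Finset.sum_nonneg fun x _ => mul_nonneg (mul_nonneg (hR0 i x) (hR0' j x)) (hK0 x))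
    (fun i => ?_) (fun j => ?_) (fun i j h => ?_) (hΔ.trans (le_of_eq ?_))
  · refine le_trans ?_ (hRa i)
    rw [Finset.sum_comm]
    refine Finset.sum_le_sum fun x _ => ?_
    rw [← Finset.sum_mul, ← Finset.mul_sum, mul_assoc]
    exact mul_le_of_le_one_right (hR0 i x) (hKF' x)
  · refine le_trans ?_ (hRb j)
    rw [Finset.sum_comm]
    refine Finset.sum_le_sum fun x _ => ?_
    rw [← Finset.sum_mul, ← Finset.sum_mul, mul_right_comm]
    exact mul_le_of_le_one_left (hR0' j x) (hKF x)
  · obtain ⟨x, _, hx⟩ := Finset.exists_ne_zero_of_sum_ne_zero h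
    have h1 := left_ne_zero_of_mul hx
    exact hg i j x (left_ne_zero_of_mul h1) (right_ne_zero_of_mul h1)
  · have : ∀ i, ∑ j, ∑ x, R i x * R' j x * K x = ∑ x, R i x * (F' x * K x) := by
      intro i
      rw [Finset.sum_comm]
      refine Finset.sum_congr rfl fun x _ => ?_
      rw [← Finset.sum_mul, ← Finset.mul_sum, mul_assoc]
    simp only [this]
    rw [Finset.sum_comm]
    refine Finset.sum_congr rfl fun x _ => ?_
    rw [← Finset.sum_mul, ← mul_assoc, hK1]

/-- The version of `exists_perm_of_labels` for labels that consist of a cell `c i` and a random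
mark, most pairs of a point and its mark being good. -/
theorem exists_perm_of_marks {K β : Type*} [Fintype K] [DecidableEq K] [Fintype β]
    {a b : ι → ℝ} (ha1 : ∑ i, a i = 1) (hb1 : ∑ i, b i = 1) (J J' : ι → β → ℝ)
    (hJ0 : ∀ i x, 0 ≤ J i x) (hJ0' : ∀ i x, 0 ≤ J' i x)
    (hJa : ∀ i, ∑ x, J i x = a i) (hJb : ∀ i, ∑ x, J' i x = b i)
    (c : ι → K) (g : ι → κ) (G G' : ι → β → Prop) [∀ i x, Decidable (G i x)]
    [∀ i x, Decidable (G' i x)] {t θ δ : ℝ} (ht : 0 ≤ t)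
    (hθ : ∑ i, ∑ x, (if G i x then 0 else J i x) ≤ θ)
    (hθ' : ∑ i, ∑ x, (if G' i x then 0 else J' i x) ≤ θ)
    (hG : ∀ i j x, c i = c j → G i x → G' j x →
      g i = g j ∧ |a i - b j| ≤ t * max (a i) (b j))
    (hδ : ∑ y : K × β, |(∑ i with c i = y.1, J i y.2) - ∑ i with c i = y.1, J' i y.2| ≤ 2 * δ) :
    ∃ σ : Equiv.Perm ι, (∀ i, g (σ i) = g i) ∧
      ∑ i, |a i - b (σ i)| ≤ 2 * (δ + 2 * θ) + 3 * t := by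
  have ha0 : ∀ i, 0 ≤ a i := fun i => hJa i ▸ Finset.sum_nonneg fun x _ => hJ0 i x
  have hb0 : ∀ i, 0 ≤ b i := fun i => hJb i ▸ Finset.sum_nonneg fun x _ => hJ0' i x
  have key : ∀ (f : ι → β → ℝ) (i : ι), ∑ y : K × β, (if c i = y.1 then f i y.2 else 0) =
      ∑ x, f i x := by
    intro f i
    rw [Fintype.sum_prod_type_right]
    simp
  have nn : ∀ {P : Prop} [Decidable P] {r : ℝ}, 0 ≤ r → 0 ≤ if P then r else 0 := by
    intro P _ r hr
    split_ifs
    exacts [hr, le_rfl]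
  have sub : ∀ {P : Prop} [Decidable P] {r : ℝ}, 0 ≤ r → (if P then r else 0) ≤ r := by
    intro P _ r hr
    split_ifs
    exacts [le_rfl, hr]
  refine exists_perm_of_labels ha0 hb0 ha1 hb1
    (fun i (y : K × β) => if c i = y.1 then (if G i y.2 then J i y.2 else 0) else 0)
    (fun i (y : K × β) => if c i = y.1 then (if G' i y.2 then J' i y.2 else 0) else 0) g ht
    (fun i y => nn (nn (hJ0 i _))) (fun i y => nn (nn (hJ0' i _)))
    (fun i => ?_) (fun i => ?_) (fun i j y h h' => ?_) ?_
  · rw [key (fun i x => if G i x then J i x else 0), ← hJa]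
    exact Finset.sum_le_sum fun x _ => sub (hJ0 i x)
  · rw [key (fun i x => if G' i x then J' i x else 0), ← hJb]
    exact Finset.sum_le_sum fun x _ => sub (hJ0' i x)
  · rw [ne_eq, ite_eq_right_iff, Classical.not_imp, ite_eq_right_iff, Classical.not_imp] at h h'
    exact hG i j y.2 (h.1.trans h'.1.symm) h.2.1 h'.2.1
  · set F : K × β → ℝ := fun y => ∑ i with c i = y.1, J i y.2 with hF
    set F' : K × β → ℝ := fun y => ∑ i with c i = y.1, J' i y.2 with hF'
    have tot : ∀ f : ι → β → ℝ, ∑ y : K × β, ∑ i with c i = y.1, f i y.2 = ∑ i, ∑ x, f i x := by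
      intro f
      simp only [Finset.sum_filter]
      rw [Finset.sum_comm]
      exact Finset.sum_congr rfl fun i _ => key f i
    have hF1 : ∑ y, F y = 1 := by
      rw [hF, tot, ← ha1]
      exact Finset.sum_congr rfl fun i _ => hJa i
    have hF1' : ∑ y, F' y = 1 := by
      rw [hF', tot, ← hb1]
      exact Finset.sum_congr rfl fun i _ => hJb i
    have split : ∀ (f : ι → β → ℝ) (H : ι → β → Prop) [∀ i x, Decidable (H i x)] (y : K × β),
        (∑ i, if c i = y.1 then (if H i y.2 then f i y.2 else 0) else 0) =
          (∑ i with c i = y.1, f i y.2) - ∑ i with c i = y.1, if H i y.2 then 0 else f i y.2 := by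
      intro f H _ y
      rw [← Finset.sum_filter, ← Finset.sum_sub_distrib]
      refine Finset.sum_congr rfl fun i _ => ?_
      split_ifs <;> simp
    simp only [split]
    -- The first term is `min (F y) (F' y)`; removing both bad masses from it bounds the minimum of
    -- the two reduced masses from below. The sum is at least `1 - δ - 2 θ`.
    have low : ∑ y : K × β, ((F y + F' y - |F y - F' y|) / 2
        - (∑ i with c i = y.1, if G i y.2 then 0 else J i y.2)
        - ∑ i with c i = y.1, if G' i y.2 then 0 else J' i y.2) ≤
        ∑ y : K × β, min (F y - ∑ i with c i = y.1, if G i y.2 then 0 else J i y.2)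
          (F' y - ∑ i with c i = y.1, if G' i y.2 then 0 else J' i y.2) := by
      refine Finset.sum_le_sum fun y _ => ?_
      have h1 : 0 ≤ ∑ i with c i = y.1, if G i y.2 then 0 else J i y.2 :=
        Finset.sum_nonneg fun i _ => by split_ifs; exacts [le_rfl, hJ0 i _]
      have h2 : 0 ≤ ∑ i with c i = y.1, if G' i y.2 then 0 else J' i y.2 :=
        Finset.sum_nonneg fun i _ => by split_ifs; exacts [le_rfl, hJ0' i _]
      have h3 := le_abs_self (F y - F' y)
      have h4 := neg_abs_le (F y - F' y)
      refine le_min ?_ ?_ <;> linarith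
    refine le_trans ?_ low
    simp only [Finset.sum_sub_distrib, ← Finset.sum_div, Finset.sum_add_distrib, hF1, hF1']
    rw [tot (fun i x => if G i x then 0 else J i x), tot (fun i x => if G' i x then 0 else J' i x)]
    linarith

end Matching

/-! ### Atlases and permutations that preserve their intervals -/

section Atlases

variable {n : ℕ}

theorem Composition.monotone_index (I : Composition n) : Monotone I.index := by
  intro i j hij
  by_contra h
  rw [not_le] at h
  have h1 := I.lt_sizeUpTo_index_succ j
  have h2 := I.sizeUpTo_index_le i
  have h3 : I.sizeUpTo (I.index j).succ ≤ I.sizeUpTo (I.index i) :=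
    I.monotone_sizeUpTo (Nat.succ_le_of_lt h)
  have h4 : (i : ℕ) ≤ j := hij
  simp only [Fin.val_succ] at *
  omega

theorem inventory_eq_map_filter (μ : PMF (Fin n)) (I : Composition n) (j : Fin I.length) :
    inventory μ I j =
      (Finset.univ.filter fun i => I.index i = j).val.map fun i => (μ i).toReal := by
  have : (Finset.univ.filter fun i => I.index i = j) =
      Finset.univ.map (I.embedding j).toEmbedding := by
    ext i
    simp only [Finset.mem_filter, Finset.mem_univ, true_and, Finset.mem_map]
    rw [eq_comm, ← I.mem_range_embedding_iff']
    simp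
  rw [this, Finset.map_val, Multiset.map_map]
  rfl

theorem map_symm_apply {α : Type*} (μ : PMF α) (σ : Equiv.Perm α) (i : α) :
    μ.map σ.symm i = μ (σ i) := by
  classical
  rw [PMF.map_apply, tsum_eq_single (σ i)]
  · simp
  · intro j hj
    rw [if_neg]
    rintro rfl
    simp at hj

theorem Conforms.map_symm {μ : PMF (Fin n)} {A : Atlas n} (h : Conforms μ A)
    {σ : Equiv.Perm (Fin n)} (hσ : ∀ i, A.partition.index (σ i) = A.partition.index i) :
    Conforms (μ.map σ.symm) A := by
  intro j
  rw [h j, inventory_eq_map_filter, inventory_eq_map_filter]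
  have : (Finset.univ.filter fun i => A.partition.index i = j) =
      (Finset.univ.filter fun i => A.partition.index i = j).map σ.toEmbedding := by
    ext i
    simp only [Finset.mem_filter, Finset.mem_univ, true_and, Finset.mem_map,
      Equiv.coe_toEmbedding]
    constructor
    · intro hi
      exact ⟨σ.symm i, by rw [← hσ, Equiv.apply_symm_apply, hi], by simp⟩
    · rintro ⟨i, hi, rfl⟩
      rw [hσ, hi]
  conv_lhs => rw [this]
  rw [Finset.map_val, Multiset.map_map]
  refine Multiset.map_congr rfl fun i _ => ?_
  rw [map_symm_apply]
  rfl

theorem l1Dist_triangle (μ ν χ : PMF (Fin n)) : l1Dist μ χ ≤ l1Dist μ ν + l1Dist ν χ := by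
  unfold l1Dist
  rw [← Finset.sum_add_distrib]
  exact Finset.sum_le_sum fun i _ => abs_sub_le _ _ _

theorem l1Dist_map_symm (μ χ : PMF (Fin n)) (σ : Equiv.Perm (Fin n)) :
    l1Dist (μ.map σ.symm) (χ.map σ.symm) = l1Dist μ χ := by
  unfold l1Dist
  simp only [map_symm_apply]
  exact Equiv.sum_comp σ fun i => |(μ i).toReal - (χ i).toReal|

/-- If every interval partition into at most `k` intervals is preserved by a permutation that
takes `μ` close to `μ'`, then `μ'` is not much farther from `S` than `μ`. -/
theorem distToSet_lt_of_perm {S : Set (PMF (Fin n))} {𝔸 : Set (Atlas n)} {k : ℕ} {δ : ℝ}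
    (hk : ∀ A ∈ 𝔸, A.length ≤ k) (hS : ∀ μ ∈ S, ∃ A ∈ 𝔸, Conforms μ A)
    (hA : ∀ A ∈ 𝔸, ∀ μ : PMF (Fin n), Conforms μ A → ¬ IsFar δ μ S)
    {μ μ' : PMF (Fin n)} {η ε ρ : ℝ} (hη : 0 ≤ η) (hρ : ρ + δ < ε) (hε : 0 < ε)
    (hperm : ∀ I : Composition n, I.length ≤ k → ∃ σ : Equiv.Perm (Fin n),
      (∀ i, I.index (σ i) = I.index i) ∧ ∑ i, |(μ' i).toReal - (μ (σ i)).toReal| ≤ ρ)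
    (hμ : distToSet μ S ≤ ENNReal.ofReal η) :
    distToSet μ' S < ENNReal.ofReal (η + ε) := by
  -- The infimum that defines the distance need not be attained; the slack `ξ` pays for a nearly
  -- optimal `χ`.
  set ξ := ε - (ρ + δ) with hξ
  have hξ0 : 0 < ξ := sub_pos.2 hρ
  have h1 : distToSet μ S < ENNReal.ofReal (η + ξ) :=
    hμ.trans_lt ((ENNReal.ofReal_lt_ofReal_iff (by linarith)).2 (by linarith))
  simp only [distToSet, iInf_lt_iff] at h1
  obtain ⟨χ, hχ, h1⟩ := h1
  rw [ENNReal.ofReal_lt_ofReal_iff (by linarith)] at h1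
  obtain ⟨A, hA𝔸, hχA⟩ := hS χ hχ
  obtain ⟨σ, hσ, hσρ⟩ := hperm A.partition (hk A hA𝔸)
  have h2 := hA A hA𝔸 _ (hχA.map_symm hσ)
  simp only [IsFar, not_forall, not_lt] at h2
  obtain ⟨χ', hχ', h2⟩ := h2
  have h3 : l1Dist μ' (μ.map σ.symm) ≤ ρ := by
    unfold l1Dist
    simpa only [map_symm_apply] using hσρ
  have h4 := l1Dist_triangle μ' (μ.map σ.symm) χ'
  have h5 := l1Dist_triangle (μ.map σ.symm) (χ.map σ.symm) χ'
  rw [l1Dist_map_symm] at h5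
  simp only [distToSet, iInf_lt_iff]
  exact ⟨χ', hχ', (ENNReal.ofReal_lt_ofReal_iff (by linarith)).2 (by linarith)⟩

/-- If the classes of a monotone map `c` that have several elements are light, then so is the set
of the points whose class meets several of `ℓ` consecutive blocks. -/
theorem sum_crossing_le {K : Type*} [LinearOrder K] {ℓ : ℕ} {a : Fin n → ℝ} (ha : ∀ i, 0 ≤ a i)
    {c : Fin n → K} (hc : Monotone c) {g : Fin n → Fin ℓ} (hg : Monotone g) {w : ℝ} (hw : 0 ≤ w)
    (hlight : ∀ i j, i < j → c i = c j → ∑ x ∈ Finset.Icc i j, a x ≤ w)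
    (X : Finset (Fin n)) (hX : ∀ i ∈ X, ∃ j, c j = c i ∧ g j ≠ g i) :
    ∑ i ∈ X, a i ≤ ℓ * w := by
  classical
  have hne : ∀ i, (Finset.univ.filter fun j => c j = c i).Nonempty := fun i => ⟨i, by simp⟩
  set lo : Fin n → Fin n := fun i => (Finset.univ.filter fun j => c j = c i).min' (hne i) with hlo
  set hi : Fin n → Fin n := fun i => (Finset.univ.filter fun j => c j = c i).max' (hne i) with hhi
  have clo : ∀ i, c (lo i) = c i := fun i =>
    (Finset.mem_filter.1 (Finset.min'_mem _ (hne i))).2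
  have chi : ∀ i, c (hi i) = c i := fun i =>
    (Finset.mem_filter.1 (Finset.max'_mem _ (hne i))).2
  have lole : ∀ i j, c j = c i → lo i ≤ j := fun i j h =>
    Finset.min'_le _ _ (by simpa using h)
  have lehi : ∀ i j, c j = c i → j ≤ hi i := fun i j h =>
    Finset.le_max' _ _ (by simpa using h)
  have sep : ∀ i ∈ X, ∃ j, c j = c i ∧ g (lo i) < g j := by
    intro i hi
    obtain ⟨j, hj, hji⟩ := hX i hi
    have h1 := hg (lole i j hj)
    have h2 := hg (lole i i rfl)
    rcases h1.lt_or_eq with h | h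
    · exact ⟨j, hj, h⟩
    · exact ⟨i, rfl, lt_of_le_of_ne h2 fun h' => hji (h.symm.trans h')⟩
  -- Two crossing classes cannot start in the same block: the earlier one reaches a later block
  -- before the other begins. So there are at most `ℓ` crossing classes.
  have nlt : ∀ i ∈ X, ∀ j, g (lo i) = g (lo j) → ¬ c i < c j := by
    intro i hi j hij hlt
    obtain ⟨x, hx, hgx⟩ := sep i hi
    have h1 : x < lo j := by
      by_contra h
      rw [not_lt] at h
      have := hc h
      rw [clo, hx] at this
      exact absurd hlt (not_lt.2 this)
    exact absurd (hg h1.le) (not_le.2 (hij ▸ hgx))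
  rw [← Finset.sum_fiberwise X (fun i => g (lo i)) a]
  have : ∀ y : Fin ℓ, ∑ i ∈ X with g (lo i) = y, a i ≤ w := by
    intro y
    rcases (X.filter fun i => g (lo i) = y).eq_empty_or_nonempty with h | ⟨i, h⟩
    · rw [h, Finset.sum_empty]
      exact hw
    · rw [Finset.mem_filter] at h
      obtain ⟨x, hx, hgx⟩ := sep i h.1
      have hlt : lo i < hi i := lt_of_lt_of_le
        (lt_of_le_of_ne (lole i x hx) fun h' => hgx.ne (by rw [h'])) (lehi i x hx)
      refine le_trans ?_ (hlight (lo i) (hi i) hlt ((clo i).trans (chi i).symm))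
      refine Finset.sum_le_sum_of_subset_of_nonneg (fun j hj => ?_) fun j _ _ => ha j
      rw [Finset.mem_filter] at hj
      have hij : g (lo i) = g (lo j) := h.2.trans hj.2.symm
      have hcij : c j = c i := le_antisymm (not_lt.1 (nlt i h.1 j hij))
        (not_lt.1 (nlt j hj.1 i hij.symm))
      exact Finset.mem_Icc.2 ⟨lole i j hcij, lehi i j hcij⟩
  refine (Finset.sum_le_sum fun y _ => this y).trans_eq ?_
  simp

end Atlases

/-! ### Concentration -/

namespace PMF

variable {α : Type*}

theorem prob_le_of_support (p : PMF α) {s t : Set α} (h : ∀ a, p a ≠ 0 → a ∈ s → a ∈ t) :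
    p.prob s ≤ p.prob t := by
  refine p.expect_mono_of_ne_zero fun a ha => ?_
  by_cases hs : a ∈ s
  · simp [hs, h a ha hs]
  · simp [hs]

theorem length_of_mem_support_iid (p : PMF α) (N : ℕ) (l : List α) (h : p.iid N l ≠ 0) :
    l.length = N := by
  induction N generalizing l with
  | zero =>
    rw [← mem_support_iff, iid, mem_support_pure_iff] at h
    simp [h]
  | succ N ih =>
    rw [← mem_support_iff, iid, mem_support_bind_iff] at h
    obtain ⟨a, _, h⟩ := h
    rw [mem_support_map_iff] at h
    obtain ⟨l, hl, rfl⟩ := h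
    simp [ih l hl]

/-- The variance is at most the mean `m`. The square is expanded as `(c - m)² + 2 m c = c² + m²`,
and the finite `2 m²` is cancelled at the end. -/
theorem expect_sq_countP_sub_le (p : PMF α) (N : ℕ) (s : Set α) [DecidablePred (· ∈ s)] :
    ((p.iid N).expect fun l =>
      ENNReal.ofReal (((l.countP (· ∈ s) : ℝ) - N * (p.prob s).toReal) ^ 2)) ≤ N * p.prob s := by
  have ht : p.prob s ≠ ∞ := ne_top_of_le_ne_top ENNReal.one_ne_top (p.prob_le_one s)
  have hpt : ∀ l : List α, ENNReal.ofReal (((l.countP (· ∈ s) : ℝ) - N * (p.prob s).toReal) ^ 2)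
      + (2 * (N * p.prob s)) * l.countP (· ∈ s) =
      (l.countP (· ∈ s) : ℝ≥0∞) ^ 2 + (N * p.prob s) ^ 2 := by
    intro l
    set c := l.countP (· ∈ s)
    have h1 : (c : ℝ≥0∞) = ENNReal.ofReal c := by simp
    have h2 : (N : ℝ≥0∞) * p.prob s = ENNReal.ofReal (N * (p.prob s).toReal) := by
      rw [ENNReal.ofReal_mul (by positivity), ENNReal.ofReal_toReal ht]
      simp
    have h3 : 0 ≤ N * (p.prob s).toReal := by positivity
    rw [h1, h2, show (2 : ℝ≥0∞) = ENNReal.ofReal 2 by simp, ← ENNReal.ofReal_mul (by positivity),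
      ← ENNReal.ofReal_mul (by positivity), ← ENNReal.ofReal_pow (by positivity),
      ← ENNReal.ofReal_pow (by positivity), ← ENNReal.ofReal_add (by positivity) (by positivity),
      ← ENNReal.ofReal_add (by positivity) (by positivity)]
    congr 1
    ring
  have h1 := congrArg (p.iid N).expect (funext hpt)
  rw [expect_add, expect_add, expect_const_mul, expect_const, expect_countP_iid] at h1
  have h2 := p.expect_countP_sq_iid_le s N
  set m := (N : ℝ≥0∞) * p.prob s
  have hm : m ≠ ∞ := ENNReal.mul_ne_top (ENNReal.natCast_ne_top N) ht
  have h3 : 2 * m * m ≠ ∞ := ENNReal.mul_ne_top (ENNReal.mul_ne_top (by simp) hm) hm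
  refine (ENNReal.add_le_add_iff_right h3).1 ?_
  rw [h1]
  refine (add_le_add_left h2 _).trans_eq ?_
  ring

/-- The empirical distribution of `N` samples is close to the sampled distribution. -/
theorem prob_iid_empirical_le [Fintype α] [BEq α] [LawfulBEq α] (p : PMF α) (N : ℕ) {δ : ℝ}
    (hδ : 0 ≤ δ) :
    ENNReal.ofReal (N * δ ^ 2) *
      (p.iid N).prob {l | δ < ∑ a, |(l.count a : ℝ) / N - (p a).toReal|} ≤ Fintype.card α := by
  classical
  rcases Nat.eq_zero_or_pos N with rfl | hN
  · simp
  have hN' : (0 : ℝ) < N := by exact_mod_cast hN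
  set V : List α → ℝ := fun l => ∑ a, ((l.count a : ℝ) - N * (p a).toReal) ^ 2 with hV
  have hE : (p.iid N).expect (fun l => ENNReal.ofReal (V l)) ≤ N := by
    have : ∀ l, ENNReal.ofReal (V l) =
        ∑ a, ENNReal.ofReal (((l.count a : ℝ) - N * (p a).toReal) ^ 2) := fun l =>
      ENNReal.ofReal_sum_of_nonneg fun a _ => sq_nonneg _
    simp only [this]
    rw [expect_finset_sum]
    calc _ ≤ ∑ a, (N : ℝ≥0∞) * p a := by
          refine Finset.sum_le_sum fun a _ => ?_
          have h := p.expect_sq_countP_sub_le N {a}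
          rw [prob_singleton] at h
          simpa [List.count, Set.mem_singleton_iff, beq_eq_decide] using h
      _ = N := by
          rw [← Finset.mul_sum, ← tsum_fintype (L := .unconditional α), p.tsum_coe, mul_one]
  -- By Cauchy–Schwarz a large `ℓ₁` deviation forces a large sum of squares `V`, whose mean is at
  -- most `N`; Markov's inequality finishes.
  have hsub : {l | δ < ∑ a, |(l.count a : ℝ) / N - (p a).toReal|} ⊆
      {l | ENNReal.ofReal (N * (N * δ ^ 2)) ≤ (Fintype.card α : ℝ≥0∞) * ENNReal.ofReal (V l)} := by
    intro l hl
    rw [Set.mem_ofPred_eq] at hl ⊢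
    have h1 : ∑ a, |(l.count a : ℝ) / N - (p a).toReal| =
        (∑ a, |(l.count a : ℝ) - N * (p a).toReal|) / N := by
      rw [Finset.sum_div]
      refine Finset.sum_congr rfl fun a _ => ?_
      rw [eq_div_iff hN'.ne', ← abs_of_pos hN', ← abs_mul, abs_of_pos hN']
      congr 1
      field_simp
    rw [h1, lt_div_iff₀ hN'] at hl
    have h2 : (∑ a, |(l.count a : ℝ) - N * (p a).toReal|) ^ 2 ≤ Fintype.card α * V l := by
      have := sq_sum_le_card_mul_sum_sq (s := (Finset.univ : Finset α))
        (f := fun a => |(l.count a : ℝ) - N * (p a).toReal|)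
      simpa only [sq_abs, Finset.card_univ] using this
    rw [show (Fintype.card α : ℝ≥0∞) = ENNReal.ofReal (Fintype.card α) by simp,
      ← ENNReal.ofReal_mul (by positivity)]
    refine ENNReal.ofReal_le_ofReal (le_trans ?_ h2)
    calc (N : ℝ) * (N * δ ^ 2) = (δ * N) ^ 2 := by ring
      _ ≤ _ := by gcongr
  have h := (mul_le_mul_right ((p.iid N).prob_mono hsub) _).trans
    ((p.iid N).mul_prob_le_expect _ (ENNReal.ofReal (N * (N * δ ^ 2))))
  rw [expect_const_mul, ENNReal.ofReal_mul hN'.le, ENNReal.ofReal_natCast] at h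
  have h' := h.trans (mul_le_mul_right hE _)
  rw [mul_comm (Fintype.card α : ℝ≥0∞), mul_assoc] at h'
  exact (ENNReal.mul_le_mul_iff_right (by exact_mod_cast hN.ne') (ENNReal.natCast_ne_top N)).1 h'

end PMF

/-! ### Marks of points and cells of samples -/

section Marks

variable {n : ℕ}

/-- The logarithm of `x`, rounded down to a multiple of `1 / d`. -/
noncomputable def logMark (d M : ℕ) (u x : ℝ) : Fin (M + 1) :=
  ⟨min ⌊Real.log (x * u) * d⌋₊ M, Nat.lt_succ_of_le (min_le_right _ _)⟩

/-- The bounds on `x` and `y` exclude both truncations in `logMark`: the natural floor at `0` and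
the cap at `M`. -/
theorem le_exp_mul_of_logMark_eq {d M : ℕ} {u x y : ℝ} (hd : 0 < d) (hu : 0 < u)
    (h : logMark d M u x = logMark d M u y) (hx : 1 ≤ x * u) (hy : 1 ≤ y * u)
    (hxM : Real.log (x * u) * d ≤ M) (hyM : Real.log (y * u) * d ≤ M) :
    x ≤ Real.exp (1 / d) * y := by
  have hd' : (0 : ℝ) < d := by exact_mod_cast hd
  have h1 : ⌊Real.log (x * u) * d⌋₊ = ⌊Real.log (y * u) * d⌋₊ := by
    have := congrArg Fin.val h
    simp only [logMark] at this
    rwa [min_eq_left (Nat.floor_le_of_le hxM), min_eq_left (Nat.floor_le_of_le hyM)] at this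
  have h2 := Nat.lt_floor_add_one (Real.log (x * u) * d)
  have h3 := Nat.floor_le (mul_nonneg (Real.log_nonneg hy) hd'.le)
  rw [h1] at h2
  have h4 : Real.log (x * u) ≤ 1 / d + Real.log (y * u) := by
    have : Real.log (x * u) * d ≤ (1 / d + Real.log (y * u)) * d := by
      rw [add_mul, one_div_mul_cancel hd'.ne']
      linarith
    exact le_of_mul_le_mul_right this hd'
  have h5 : x * u ≤ Real.exp (1 / d) * (y * u) := by
    rw [← Real.exp_log (show 0 < x * u by linarith), ← Real.exp_log (show 0 < y * u by linarith),
      ← Real.exp_add]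
    simpa using h4
  rw [← mul_assoc] at h5
  exact le_of_mul_le_mul_right h5 hu

theorem one_sub_three_mul_le {a b x y τ : ℝ} (ha : 0 ≤ a) (hb : 0 ≤ b) (hτ1 : τ ≤ 1)
    (hx : |x - a| ≤ τ * a) (hy : |y - b| ≤ τ * b) (hxy : x ≤ Real.exp τ * y) :
    (1 - 3 * τ) * a ≤ b := by
  have h1 : (1 - τ) * a ≤ x := by linarith [neg_le_of_abs_le hx]
  have h2 : y ≤ (1 + τ) * b := by linarith [le_of_abs_le hy]
  have h3 : 1 - τ ≤ Real.exp (-τ) := by linarith [Real.add_one_le_exp (-τ)]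
  have h4 : 0 ≤ x := le_trans (mul_nonneg (by linarith) ha) h1
  have h5 : (1 - τ) * x ≤ y := by
    calc (1 - τ) * x ≤ Real.exp (-τ) * x := by gcongr
      _ ≤ Real.exp (-τ) * (Real.exp τ * y) := by gcongr
      _ = y := by rw [← mul_assoc, ← Real.exp_add, neg_add_cancel, Real.exp_zero, one_mul]
  have h6 : (1 - τ) * ((1 - τ) * a) ≤ (1 + τ) * b :=
    (mul_le_mul_of_nonneg_left h1 (by linarith)).trans (h5.trans h2)
  -- The third factor `1 - τ` replaces a division: `(1 - τ)(1 + τ) ≤ 1`, while `(1 - τ)³ ≥ 1 - 3 τ`.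
  have h7 : (1 - τ) * ((1 - τ) * ((1 - τ) * a)) ≤ (1 - τ) * ((1 + τ) * b) :=
    mul_le_mul_of_nonneg_left h6 (by linarith)
  have h8 : 0 ≤ τ ^ 2 * (3 - τ) * a := by
    have : 0 ≤ 3 - τ := by linarith
    positivity
  have h9 : 0 ≤ τ ^ 2 * b := by positivity
  nlinarith

/-- An accurate estimate of a weight in `[1/(nd), 1]` lies in `[1/(2nd), 2]`. This explains the
scale `2 n d` and the argument `4 n d` of the logarithm in `hM`. -/
theorem abs_sub_le_of_logMark_eq {d M : ℕ} (hd : 0 < d) (hn : 0 < n)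
    (hM : Real.log (4 * n * d) * d ≤ M) {a b x y : ℝ}
    (ha : 1 ≤ a * (n * d)) (hb : 1 ≤ b * (n * d)) (ha1 : a ≤ 1) (hb1 : b ≤ 1)
    (hx : |x - a| ≤ 1 / (2 * d) * a) (hy : |y - b| ≤ 1 / (2 * d) * b)
    (h : logMark d M (2 * n * d) x = logMark d M (2 * n * d) y) :
    |a - b| ≤ 3 / d * max a b := by
  have hd' : (1 : ℝ) ≤ d := by exact_mod_cast hd
  have hn' : (1 : ℝ) ≤ n := by exact_mod_cast hn
  have hnd : (0 : ℝ) < n * d := by positivity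
  have a0 : 0 < a := pos_of_mul_pos_left (by linarith) hnd.le
  have b0 : 0 < b := pos_of_mul_pos_left (by linarith) hnd.le
  have hτ : 1 / (2 * d : ℝ) ≤ 1 / 2 := by
    rw [div_le_div_iff₀ (by positivity) (by norm_num)]
    linarith
  have hττ : 1 / (2 * d : ℝ) ≤ 1 / d := by
    rw [div_le_div_iff₀ (by positivity) (by positivity)]
    linarith
  have bounds : ∀ a x : ℝ, 0 < a → a ≤ 1 → 1 ≤ a * (n * d) → |x - a| ≤ 1 / (2 * d) * a →
      1 ≤ x * (2 * n * d) ∧ Real.log (x * (2 * n * d)) * d ≤ M := by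
    intro a x a0 a1 ha hx
    have h0 : 1 / (2 * d : ℝ) * a ≤ 1 / 2 * a := by gcongr
    have h1 : a / 2 ≤ x := by linarith [neg_le_of_abs_le hx]
    have h2 : x ≤ 2 := by linarith [le_of_abs_le hx]
    have h3 : 1 ≤ x * (2 * n * d) := by
      calc 1 ≤ a * (n * d) := ha
        _ = a / 2 * (2 * n * d) := by ring
        _ ≤ _ := by gcongr
    refine ⟨h3, le_trans ?_ hM⟩
    refine mul_le_mul_of_nonneg_right (Real.log_le_log (by linarith) ?_) (by linarith)
    calc x * (2 * n * d) ≤ 2 * (2 * n * d) := by gcongr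
      _ = _ := by ring
  obtain ⟨hx1, hx2⟩ := bounds a x a0 ha1 ha hx
  obtain ⟨hy1, hy2⟩ := bounds b y b0 hb1 hb hy
  have hxy := le_exp_mul_of_logMark_eq hd (by positivity) h hx1 hy1 hx2 hy2
  have hyx := le_exp_mul_of_logMark_eq hd (by positivity) h.symm hy1 hx1 hy2 hx2
  have hx' : |x - a| ≤ 1 / d * a := hx.trans (by gcongr)
  have hy' : |y - b| ≤ 1 / d * b := hy.trans (by gcongr)
  have hτ1 : 1 / (d : ℝ) ≤ 1 := by
    rw [div_le_one (by linarith)]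
    exact hd'
  have e1 := one_sub_three_mul_le a0.le b0.le hτ1 hx' hy' hxy
  have e2 := one_sub_three_mul_le b0.le a0.le hτ1 hy' hx' hyx
  have h3 : 3 / (d : ℝ) = 3 * (1 / d) := by ring
  have m1 : 3 * (1 / d) * a ≤ 3 * (1 / d) * max a b := by
    gcongr
    exact le_max_left _ _
  have m2 : 3 * (1 / d) * b ≤ 3 * (1 / d) * max a b := by
    gcongr
    exact le_max_right _ _
  rw [h3, abs_le]
  constructor <;> linarith

theorem List.forall_of_countP_eq {α : Type*} {p q : α → Bool} (hpq : ∀ x, p x → q x)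
    (l : List α) (h : l.countP p = l.countP q) : ∀ x ∈ l, q x → p x := by
  induction l with
  | nil => simp
  | cons y l ih =>
    have h1 : l.countP p ≤ l.countP q := List.countP_mono_left fun x _ => hpq x
    rw [List.countP_cons, List.countP_cons] at h
    have hy := hpq y
    have h2 : (if p y then 1 else 0) ≤ if q y then 1 else 0 := by
      split_ifs <;> simp_all
    intro x hx hqx
    rcases List.mem_cons.1 hx with rfl | hx
    · by_contra hp
      rw [if_pos hqx, if_neg hp] at h
      omega
    · exact ih (by omega) x hx hqx

/-- The index of the cell of `i` among the points of `xs` and the gaps between them. -/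
def cellIndex (s : ℕ) (xs : List (Fin n)) (i : Fin n) : Fin (2 * s + 1) :=
  ⟨min (xs.countP (· < i) + xs.countP (· ≤ i)) (2 * s), Nat.lt_succ_of_le (min_le_right _ _)⟩

theorem monotone_cellIndex (s : ℕ) (xs : List (Fin n)) : Monotone (cellIndex s xs) := by
  intro i j hij
  have h1 : xs.countP (· < i) ≤ xs.countP (· < j) :=
    List.countP_mono_left fun x _ h => by
      simp only [decide_eq_true_eq] at h ⊢
      exact h.trans_le hij
  have h2 : xs.countP (· ≤ i) ≤ xs.countP (· ≤ j) :=
    List.countP_mono_left fun x _ h => by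
      simp only [decide_eq_true_eq] at h ⊢
      exact h.trans hij
  exact Fin.mk_le_mk.2 (min_le_min_right _ (add_le_add h1 h2))

/-- The numbers of samples `< i`, `≤ i`, `< j`, `≤ j` increase in this order, so equal indices force
all four to agree: every sample `≤ j` is `< i`. With `s` samples the cap `2 * s` is never active. -/
theorem notMem_Icc_of_cellIndex_eq {s : ℕ} {xs : List (Fin n)} (hs : xs.length = s) {i j : Fin n}
    (hij : i < j) (h : cellIndex s xs i = cellIndex s xs j) : ∀ x ∈ xs, x ∉ Set.Icc i j := by
  have hlen : ∀ p : Fin n → Bool, xs.countP p ≤ s := fun p => hs ▸ List.countP_le_length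
  have h0 := congrArg Fin.val h
  simp only [cellIndex] at h0
  rw [min_eq_left (by linarith [hlen (· < i), hlen (· ≤ i)]),
    min_eq_left (by linarith [hlen (· < j), hlen (· ≤ j)])] at h0
  have h1 : xs.countP (· < i) ≤ xs.countP (· ≤ i) :=
    List.countP_mono_left fun x _ h => by
      simp only [decide_eq_true_eq] at h ⊢
      exact h.le
  have h2 : xs.countP (· ≤ i) ≤ xs.countP (· < j) :=
    List.countP_mono_left fun x _ h => by
      simp only [decide_eq_true_eq] at h ⊢
      exact h.trans_lt hij
  have h3 : xs.countP (· < j) ≤ xs.countP (· ≤ j) :=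
    List.countP_mono_left fun x _ h => by
      simp only [decide_eq_true_eq] at h ⊢
      exact h.le
  have h4 := List.forall_of_countP_eq (p := (· < i)) (q := (· ≤ j)) (fun x hx => by
    simp only [decide_eq_true_eq] at hx ⊢
    exact (hx.trans hij).le) xs (by omega)
  intro x hx hxij
  have := h4 x hx (by simpa using hxij.2)
  simp only [decide_eq_true_eq] at this
  exact absurd hxij.1 (not_le.2 this)

/-- The law of a random point of `μ` with the mark of its estimated probability. -/
noncomputable def markedPoint (d M r L : ℕ) (μ : PMF (Fin n)) : PMF (Fin n × Fin (M + 1)) :=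
  (pointEstimate r L μ).map (Prod.map id fun x => logMark d M (2 * n * d) x.toReal)

theorem map_fst_markedPoint (d M r L : ℕ) (μ : PMF (Fin n)) :
    (markedPoint d M r L μ).map Prod.fst = μ := by
  rw [markedPoint, PMF.map_comp]
  exact map_fst_pointEstimate r L μ

theorem PMF.toReal_map_apply {α β : Type*} [Fintype α] [DecidableEq β] (p : PMF α) (f : α → β)
    (b : β) : (p.map f b).toReal = ∑ a with f a = b, (p a).toReal := by
  classical
  rw [PMF.map_apply, tsum_fintype, ← ENNReal.toReal_sum fun a _ => p.apply_ne_top a,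
    Finset.sum_filter]
  congr 1
  refine Finset.sum_congr rfl fun a _ => ?_
  by_cases h : f a = b
  · rw [if_pos h, if_pos h.symm]
  · rw [if_neg h, if_neg (Ne.symm h)]

theorem PMF.toReal_prob {α : Type*} [Fintype α] (p : PMF α) (s : Set α) [DecidablePred (· ∈ s)] :
    (p.prob s).toReal = ∑ a, if a ∈ s then (p a).toReal else 0 := by
  rw [PMF.prob, PMF.expect_fintype, ENNReal.toReal_sum]
  · refine Finset.sum_congr rfl fun a _ => ?_
    by_cases h : a ∈ s <;> simp [h]
  · intro a _
    by_cases h : a ∈ s <;> simp [h, p.apply_ne_top a]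

theorem PMF.sum_toReal {α : Type*} [Fintype α] (p : PMF α) : ∑ a, (p a).toReal = 1 := by
  rw [← ENNReal.toReal_sum fun a _ => p.apply_ne_top a,
    ← tsum_fintype (L := .unconditional α), p.tsum_coe, ENNReal.toReal_one]

theorem sum_toReal_markedPoint (d M r L : ℕ) (μ : PMF (Fin n)) (i : Fin n) :
    ∑ m, (markedPoint d M r L μ (i, m)).toReal = (μ i).toReal := by
  classical
  conv_rhs => rw [← map_fst_markedPoint d M r L μ, PMF.toReal_map_apply]
  rw [Finset.sum_filter, Fintype.sum_prod_type]
  rw [Finset.sum_eq_single i (by intro j _ hj; simp [hj]) (by simp)]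
  simp

theorem toReal_map_markedPoint {K : Type*} [DecidableEq K] (d M r L : ℕ) (μ : PMF (Fin n))
    (c : Fin n → K) (y : K × Fin (M + 1)) :
    ((markedPoint d M r L μ).map (Prod.map c id) y).toReal =
      ∑ i with c i = y.1, (markedPoint d M r L μ (i, y.2)).toReal := by
  classical
  rw [PMF.toReal_map_apply, Finset.sum_filter, Finset.sum_filter, Fintype.sum_prod_type]
  refine Finset.sum_congr rfl fun i _ => ?_
  obtain ⟨k, m⟩ := y
  simp only [Prod.map_apply, id, Prod.mk.injEq]
  by_cases h : c i = k <;> simp [h]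

/-- The mark `m` is one of an estimate that is close to `μ i`. -/
def IsAccurate (d M : ℕ) (μ : PMF (Fin n)) (i : Fin n) (m : Fin (M + 1)) : Prop :=
  ∃ x, logMark d M (2 * n * d) x = m ∧ |x - (μ i).toReal| ≤ 1 / (2 * d) * (μ i).toReal

/-- The sampled points `xs` cut `[n]` into light cells, and the marked points `ys` are typical for
`μ` with respect to these cells. -/
def IsTypical (k d M r L s N : ℕ) (μ : PMF (Fin n)) (xs : List (Fin n))
    (ys : List (Fin n × Fin (M + 1))) : Prop :=
  (∀ i j, i < j → cellIndex s xs i = cellIndex s xs j →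
    ∑ x ∈ Finset.Icc i j, (μ x).toReal ≤ 1 / (d * k)) ∧
  ∑ y, |((ys.map (Prod.map (cellIndex s xs) id)).count y : ℝ) / N -
    ((markedPoint d M r L μ).map (Prod.map (cellIndex s xs) id) y).toReal| ≤ 1 / d

/-- Two distributions for which the same samples are typical differ, up to a small distance, by a
permutation that preserves a given interval partition. -/
theorem exists_perm_of_isTypical {k d M r L s N : ℕ} (hd : 0 < d) (hn : 0 < n)
    (hM : Real.log (4 * n * d) * d ≤ M)
    (hacc : ∀ μ : PMF (Fin n), (markedPoint d M r L μ).prob {z | ¬ IsAccurate d M μ z.1 z.2} ≤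
      ENNReal.ofReal (1 / d))
    {μ μ' : PMF (Fin n)} {xs : List (Fin n)} {ys : List (Fin n × Fin (M + 1))}
    (h : IsTypical k d M r L s N μ xs ys) (h' : IsTypical k d M r L s N μ' xs ys)
    (I : Composition n) (hI : I.length ≤ k) :
    ∃ σ : Equiv.Perm (Fin n), (∀ i, I.index (σ i) = I.index i) ∧
      ∑ i, |(μ i).toReal - (μ' (σ i)).toReal| ≤ 23 / d := by
  classical
  have hd' : (0 : ℝ) < d := by exact_mod_cast hd
  have hn' : (0 : ℝ) < n := by exact_mod_cast hn
  set c := cellIndex s xs with hc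
  set X : Finset (Fin n) := Finset.univ.filter fun i => ∃ j, c j = c i ∧ I.index j ≠ I.index i
    with hX
  set J : PMF (Fin n) → Fin n → Fin (M + 1) → ℝ := fun μ i m =>
    (markedPoint d M r L μ (i, m)).toReal with hJ
  have hJ0 : ∀ μ i m, 0 ≤ J μ i m := fun _ _ _ => ENNReal.toReal_nonneg
  have hJs : ∀ μ i, ∑ m, J μ i m = (μ i).toReal := fun μ i => sum_toReal_markedPoint d M r L μ i
  -- The three ways to be bad are an inaccurate mark, a weight below `1/(nd)` and a cell that
  -- crosses a boundary of `I`. Each costs mass at most `1/d`.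
  set G : PMF (Fin n) → Fin n → Fin (M + 1) → Prop := fun μ i m =>
    IsAccurate d M μ i m ∧ 1 ≤ (μ i).toReal * (n * d) ∧ i ∉ X with hG
  have hcross : ∀ μ : PMF (Fin n), (∀ i j, i < j → c i = c j →
      ∑ x ∈ Finset.Icc i j, (μ x).toReal ≤ 1 / (d * k)) → ∑ i ∈ X, (μ i).toReal ≤ 1 / d := by
    intro μ hl
    have h1 := sum_crossing_le (fun i => ENNReal.toReal_nonneg) (monotone_cellIndex s xs)
      I.monotone_index (w := 1 / (d * k)) (by positivity) hl X
      fun i hi => (Finset.mem_filter.1 hi).2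
    refine h1.trans ?_
    rcases Nat.eq_zero_or_pos k with rfl | hk
    · rw [Nat.le_zero.1 hI]
      simp
    · have hk' : (0 : ℝ) < k := by exact_mod_cast hk
      calc (I.length : ℝ) * (1 / (d * k)) ≤ k * (1 / (d * k)) := by
            gcongr
        _ = 1 / d := by field_simp
  have hsmall : ∀ μ : PMF (Fin n),
      ∑ i, (if 1 ≤ (μ i).toReal * (n * d) then 0 else (μ i).toReal) ≤ 1 / d := by
    intro μ
    have : ∀ i, (if 1 ≤ (μ i).toReal * (n * d) then 0 else (μ i).toReal) ≤ 1 / (n * d) := by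
      intro i
      split_ifs with h
      · positivity
      · rw [le_div_iff₀ (by positivity)]
        exact (not_le.1 h).le
    refine (Finset.sum_le_sum fun i _ => this i).trans_eq ?_
    rw [Finset.sum_const, Finset.card_univ, Fintype.card_fin, nsmul_eq_mul]
    field_simp
  have hloss : ∀ μ : PMF (Fin n), ∑ i ∈ X, (μ i).toReal ≤ 1 / d →
      ∑ i, ∑ m, (if G μ i m then 0 else J μ i m) ≤ 3 / d := by
    intro μ hXμ
    have h1 : ∑ i, ∑ m, (if IsAccurate d M μ i m then 0 else J μ i m) ≤ 1 / d := by
      have h2 := ENNReal.toReal_mono ENNReal.ofReal_ne_top (hacc μ)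
      rw [ENNReal.toReal_ofReal (by positivity), PMF.toReal_prob, Fintype.sum_prod_type] at h2
      refine le_trans (le_of_eq ?_) h2
      refine Finset.sum_congr rfl fun i _ => Finset.sum_congr rfl fun m _ => ?_
      by_cases h : IsAccurate d M μ i m <;> simp [h, hJ]
    have h2 : ∀ i m, (if G μ i m then 0 else J μ i m) ≤
        (if IsAccurate d M μ i m then 0 else J μ i m) +
        (if 1 ≤ (μ i).toReal * (n * d) then 0 else J μ i m) +
        (if i ∈ X then J μ i m else 0) := by
      intro i m
      have := hJ0 μ i m
      by_cases a1 : IsAccurate d M μ i m <;> by_cases a2 : 1 ≤ (μ i).toReal * (n * d) <;>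
        by_cases a3 : i ∈ X <;> simp [hG, a1, a2, a3] <;> linarith
    have h3 : ∀ i, ∑ m, (if 1 ≤ (μ i).toReal * (n * d) then 0 else J μ i m) =
        if 1 ≤ (μ i).toReal * (n * d) then 0 else (μ i).toReal := by
      intro i
      split_ifs
      · simp
      · exact hJs μ i
    have h4 : ∀ i, ∑ m, (if i ∈ X then J μ i m else 0) = if i ∈ X then (μ i).toReal else 0 := by
      intro i
      split_ifs
      · exact hJs μ i
      · simp
    refine (Finset.sum_le_sum fun i _ => Finset.sum_le_sum fun m _ => h2 i m).trans ?_
    simp only [Finset.sum_add_distrib, h3, h4]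
    have h5 := hsmall μ
    rw [← Finset.sum_filter, Finset.filter_mem_eq_inter, Finset.univ_inter]
    have : (3 : ℝ) / d = 1 / d + 1 / d + 1 / d := by ring
    linarith
  have hle1 : ∀ (μ : PMF (Fin n)) i, (μ i).toReal ≤ 1 := fun μ i =>
    ENNReal.toReal_le_of_le_ofReal zero_le_one (by simpa using μ.coe_le_one i)
  -- The resulting bound is `2 (1/d + 2 · 3/d) + 3 · 3/d = 23/d`. The label laws are compared
  -- through the common empirical distribution.
  obtain ⟨σ, hσ, hle⟩ := exists_perm_of_marks (PMF.sum_toReal μ) (PMF.sum_toReal μ') (J μ) (J μ')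
    (hJ0 μ) (hJ0 μ') (hJs μ) (hJs μ') c I.index (G μ) (G μ') (t := 3 / d) (θ := 3 / d)
    (δ := 1 / d) (by positivity) (hloss μ (hcross μ h.1)) (hloss μ' (hcross μ' h'.1))
    (fun i j m hij hi hj => by
      obtain ⟨⟨x, hx, hxi⟩, hi1, hiX⟩ := hi
      obtain ⟨⟨y, hy, hyj⟩, hj1, hjX⟩ := hj
      refine ⟨?_, abs_sub_le_of_logMark_eq hd hn hM hi1 hj1 (hle1 μ i) (hle1 μ' j) hxi hyj
        (hx.trans hy.symm)⟩
      by_contra hne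
      exact hiX (Finset.mem_filter.2 ⟨Finset.mem_univ i, j, hij.symm, Ne.symm hne⟩))
    (by
      have h1 := h.2
      have h2 := h'.2
      simp only [← toReal_map_markedPoint, hJ]
      have h3 := add_le_add h1 h2
      rw [← Finset.sum_add_distrib] at h3
      refine (Finset.sum_le_sum fun y _ => ?_).trans (h3.trans_eq (by ring))
      refine (abs_sub_le _ (((ys.map (Prod.map (cellIndex s xs) id)).count y : ℝ) / N) _).trans_eq ?_
      rw [abs_sub_comm _ (((ys.map (Prod.map (cellIndex s xs) id)).count y : ℝ) / N)])
  refine ⟨σ, hσ, hle.trans_eq ?_⟩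
  ring

end Marks

/-! ### The tester -/

section Tester

variable {n : ℕ}

/-- Union bound over at most `n²` intervals heavier than `1/(dk)`: all samples miss a given one with
probability at most `exp (-s/(dk)) = exp (-(2l+2)) ≤ 1/(6n²)`. -/
theorem prob_not_light_le {k d l s : ℕ} (hk : 0 < k) (hd : 0 < d) (hn : 0 < n)
    (hl : Real.log n ≤ l) (hs : s = k * (d * (2 * l + 2))) (μ : PMF (Fin n)) :
    (μ.iid s).prob {xs | ¬ ∀ i j, i < j → cellIndex s xs i = cellIndex s xs j →
      ∑ x ∈ Finset.Icc i j, (μ x).toReal ≤ 1 / (d * k)} ≤ ENNReal.ofReal (1 / 6) := by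
  classical
  have hk' : (1 : ℝ) ≤ k := by exact_mod_cast hk
  have hd' : (1 : ℝ) ≤ d := by exact_mod_cast hd
  have hn' : (0 : ℝ) < n := by exact_mod_cast hn
  have hdk : (1 : ℝ) ≤ d * k := one_le_mul_of_one_le_of_one_le hd' hk'
  set Y : Finset (Fin n × Fin n) := Finset.univ.filter fun p =>
    1 / (d * k : ℝ) < ∑ x ∈ Finset.Icc p.1 p.2, (μ x).toReal with hY
  have hsub : ∀ xs, μ.iid s xs ≠ 0 →
      xs ∈ {xs | ¬ ∀ i j, i < j → cellIndex s xs i = cellIndex s xs j →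
        ∑ x ∈ Finset.Icc i j, (μ x).toReal ≤ 1 / (d * k)} →
      xs ∈ ⋃ p ∈ Y, {xs : List (Fin n) | ∀ x ∈ xs, x ∉ (Finset.Icc p.1 p.2 : Set (Fin n))} := by
    intro xs hxs h
    simp only [Set.mem_ofPred_eq, not_forall, not_le] at h
    obtain ⟨i, j, hij, hc, hlt⟩ := h
    simp only [Set.mem_iUnion]
    refine ⟨(i, j), Finset.mem_filter.2 ⟨Finset.mem_univ _, hlt⟩, fun x hx => ?_⟩
    rw [Finset.coe_Icc]
    exact notMem_Icc_of_cellIndex_eq (μ.length_of_mem_support_iid s xs hxs) hij hc x hx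
  have hp : ∀ p ∈ Y, (μ.iid s).prob
      {xs : List (Fin n) | ∀ x ∈ xs, x ∉ (Finset.Icc p.1 p.2 : Set (Fin n))} ≤
        ENNReal.ofReal (Real.exp (-(2 * l + 2))) := by
    intro p hp
    have h1 : 1 / (d * k : ℝ) < ∑ x ∈ Finset.Icc p.1 p.2, (μ x).toReal :=
      (Finset.mem_filter.1 hp).2
    rw [PMF.prob_forall_notMem_iid]
    set B : Set (Fin n) := (Finset.Icc p.1 p.2 : Set (Fin n)) with hB
    have hBt : μ.prob B ≠ ∞ := ne_top_of_le_ne_top ENNReal.one_ne_top (μ.prob_le_one B)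
    have hBt' : μ.prob Bᶜ ≠ ∞ := ne_top_of_le_ne_top ENNReal.one_ne_top (μ.prob_le_one Bᶜ)
    have h2 := congrArg ENNReal.toReal (μ.prob_add_prob_compl B)
    rw [ENNReal.toReal_add hBt hBt', ENNReal.toReal_one] at h2
    have h3 : (μ.prob B).toReal = ∑ x ∈ Finset.Icc p.1 p.2, (μ x).toReal := by
      rw [hB, PMF.prob_finset, ENNReal.toReal_sum fun a _ => μ.apply_ne_top a]
    have h4 : (μ.prob Bᶜ).toReal ≤ Real.exp (-(1 / (d * k))) := by
      have := Real.add_one_le_exp (-(1 / (d * k) : ℝ))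
      linarith
    have h5 : μ.prob Bᶜ ≤ ENNReal.ofReal (Real.exp (-(1 / (d * k)))) :=
      ENNReal.le_ofReal_iff_toReal_le hBt' (Real.exp_pos _).le |>.2 h4
    refine (pow_le_pow_left₀ zero_le h5 s).trans_eq ?_
    rw [← ENNReal.ofReal_pow (Real.exp_pos _).le, ← Real.exp_nat_mul]
    congr 2
    rw [hs]
    push_cast
    field_simp
  refine ((μ.iid s).prob_le_of_support hsub).trans ((PMF.prob_biUnion_le _ _ _).trans
    ((Finset.sum_le_sum hp).trans ?_))
  rw [Finset.sum_const, nsmul_eq_mul]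
  have hcard : Y.card ≤ n * n := by
    simpa using Finset.card_le_univ Y
  have hcard' : (Y.card : ℝ) ≤ n * n := by exact_mod_cast hcard
  rw [← ENNReal.ofReal_natCast, ← ENNReal.ofReal_mul (by positivity)]
  refine ENNReal.ofReal_le_ofReal ?_
  have hnl : (n : ℝ) ≤ Real.exp l := by
    rw [← Real.exp_log hn']
    exact Real.exp_le_exp.2 hl
  have he : Real.exp (-(2 * l + 2)) * (Real.exp l * Real.exp l) * Real.exp 2 = 1 := by
    rw [← Real.exp_add, ← Real.exp_add, ← Real.exp_add, ← Real.exp_zero]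
    congr 1
    ring
  have h6 : (6 : ℝ) ≤ Real.exp 2 := by
    have h := Real.exp_one_gt_d9
    have : Real.exp 2 = Real.exp 1 * Real.exp 1 := by
      rw [← Real.exp_add]
      norm_num
    nlinarith
  have h7 : (Y.card : ℝ) * Real.exp (-(2 * l + 2)) ≤
      Real.exp (-(2 * l + 2)) * (Real.exp l * Real.exp l) := by
    rw [mul_comm]
    gcongr
    exact hcard'.trans (by gcongr)
  refine h7.trans ?_
  rw [le_div_iff₀ (by norm_num), ← he]
  gcongr

/-- `L` halvings reach single points since `n ≤ e^l ≤ 4^l`. The choice of `r` makes `κ = 4L/r =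
1/(4d³)`, and Chebyshev with `τ = 1/(2d)` gives `κ/τ² = 1/d`. -/
theorem prob_markedPoint_not_isAccurate_le {d M l L r : ℕ} (hd : 0 < d) (hn : 0 < n)
    (hl : Real.log n ≤ l) (hL : L = 2 * l + 1) (hr : r = 16 * L * d ^ 3) (μ : PMF (Fin n)) :
    (markedPoint d M r L μ).prob {z | ¬ IsAccurate d M μ z.1 z.2} ≤ ENNReal.ofReal (1 / d) := by
  have hd' : (1 : ℝ) ≤ d := by exact_mod_cast hd
  have hn' : (0 : ℝ) < n := by exact_mod_cast hn
  have hL0 : (0 : ℝ) < L := by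
    rw [hL]
    positivity
  have hr0 : r ≠ 0 := by
    rw [hr, hL]
    positivity
  have hrR : (r : ℝ) = 16 * L * d ^ 3 := by
    rw [hr]
    push_cast
    ring
  have hn2 : n ≤ 2 ^ L := by
    have h1 : (n : ℝ) ≤ Real.exp l := by
      rw [← Real.exp_log hn']
      exact Real.exp_le_exp.2 hl
    have h2 : Real.exp l ≤ 4 ^ l := by
      rw [← mul_one (l : ℝ), Real.exp_nat_mul]
      gcongr
      have := Real.exp_one_lt_d9
      linarith
    have h3 : n ≤ 4 ^ l := by exact_mod_cast h1.trans h2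
    calc n ≤ 4 ^ l := h3
      _ = 2 ^ (2 * l) := by rw [pow_mul]; norm_num
      _ ≤ 2 ^ L := by
        rw [hL]
        exact Nat.pow_le_pow_right (by norm_num) (by omega)
  have hκ : (1 + 2 * (r : ℝ≥0∞)⁻¹) ^ L ≤ 1 + ENNReal.ofReal (1 / (4 * d ^ 3)) := by
    have h1 : (1 + 2 * (r : ℝ≥0∞)⁻¹) = ENNReal.ofReal (1 + 2 / r) := by
      rw [ENNReal.ofReal_add (by norm_num) (by positivity), ENNReal.ofReal_one,
        ENNReal.ofReal_div_of_pos (by positivity), div_eq_mul_inv]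
      simp
    rw [h1, ← ENNReal.ofReal_pow (by positivity), ← ENNReal.ofReal_one,
      ← ENNReal.ofReal_add (by norm_num) (by positivity)]
    refine ENNReal.ofReal_le_ofReal ?_
    set x : ℝ := L * (2 / r) with hx
    have hxd : x = 1 / (8 * d ^ 3) := by
      rw [hx, hrR]
      field_simp
      norm_num
    have hx0 : 0 ≤ x := by positivity
    have hd3 : (1 : ℝ) ≤ d ^ 3 := one_le_pow₀ hd'
    have hx1 : x ≤ 1 := by
      rw [hxd, div_le_one (by positivity)]
      linarith
    calc (1 + 2 / (r : ℝ)) ^ L ≤ Real.exp (2 / r) ^ L := by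
          gcongr
          rw [add_comm]
          exact Real.add_one_le_exp _
      _ = Real.exp x := by rw [← Real.exp_nat_mul]
      _ ≤ 1 + 2 * x := by
          have := Real.abs_exp_sub_one_le (x := x) (by rwa [abs_of_nonneg hx0])
          rw [abs_of_nonneg hx0] at this
          linarith [le_abs_self (Real.exp x - 1)]
      _ = _ := by
          rw [hxd]
          field_simp
          ring
  have h := prob_pointEstimate_le hr0 hn2 μ (τ := 1 / (2 * d)) (by positivity) hκ
  rw [markedPoint, PMF.prob_map]
  have hsub : (Prod.map id fun x : ℝ≥0∞ => logMark d M (2 * n * d) x.toReal) ⁻¹'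
      {z : Fin n × Fin (M + 1) | ¬ IsAccurate d M μ z.1 z.2} ⊆
      {z | 1 / (2 * d) * (μ z.1).toReal < |z.2.toReal - (μ z.1).toReal|} := by
    intro z hz
    by_contra hle
    exact hz ⟨z.2.toReal, rfl, not_lt.1 hle⟩
  refine (PMF.prob_mono _ hsub).trans ?_
  have h0 : ENNReal.ofReal ((1 / (2 * d : ℝ)) ^ 2) ≠ 0 := by
    rw [ne_eq, ENNReal.ofReal_eq_zero, not_le]
    positivity
  refine (ENNReal.mul_le_mul_iff_right h0 ENNReal.ofReal_ne_top).1 (h.trans_eq ?_)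
  rw [← ENNReal.ofReal_mul (by positivity)]
  congr 1
  field_simp
  norm_num

theorem prob_iid_markedPoint_le {d M r L s N : ℕ} (hd : 0 < d)
    (hN : N = 6 * d ^ 2 * ((2 * s + 1) * (M + 1))) (μ : PMF (Fin n)) (xs : List (Fin n)) :
    ((markedPoint d M r L μ).iid N).prob {ys | 1 / (d : ℝ) <
      ∑ y, |((ys.map (Prod.map (cellIndex s xs) id)).count y : ℝ) / N -
        ((markedPoint d M r L μ).map (Prod.map (cellIndex s xs) id) y).toReal|} ≤
      ENNReal.ofReal (1 / 6) := by
  have hd' : (0 : ℝ) < d := by exact_mod_cast hd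
  have h := PMF.prob_iid_empirical_le ((markedPoint d M r L μ).map (Prod.map (cellIndex s xs) id)) N
    (δ := 1 / d) (by positivity)
  rw [PMF.iid_map, PMF.prob_map] at h
  have hD : (Fintype.card (Fin (2 * s + 1) × Fin (M + 1)) : ℝ≥0∞) =
      ENNReal.ofReal (N * (1 / d) ^ 2) * ENNReal.ofReal (1 / 6) := by
    rw [← ENNReal.ofReal_mul (by positivity), ← ENNReal.ofReal_natCast]
    congr 1
    rw [hN]
    simp only [Fintype.card_prod, Fintype.card_fin]
    push_cast
    field_simp
  rw [hD] at h
  have h0 : ENNReal.ofReal (N * (1 / (d : ℝ)) ^ 2) ≠ 0 := by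
    rw [ne_eq, ENNReal.ofReal_eq_zero, not_le, hN]
    positivity
  exact (ENNReal.mul_le_mul_iff_right h0 ENNReal.ofReal_ne_top).1 h

/-- The law of the samples that the tester takes. -/
noncomputable def transcript (d M r L s N : ℕ) (μ : PMF (Fin n)) :
    PMF (List (Fin n) × List (Fin n × Fin (M + 1))) :=
  (μ.iid s).bind fun xs => ((markedPoint d M r L μ).iid N).map fun ys => (xs, ys)

theorem isSampled_transcript (hn : n ≠ 0) (d M r L s N : ℕ) :
    IsSampled (s + N * (1 + L * r)) (transcript (n := n) d M r L s N) := by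
  have h := (isSampled_id hn).iid s
  rw [mul_one] at h
  exact h.bind fun xs => (((isSampled_pointEstimate hn r L).map _).iid N).map _

/-- The second batch is drawn independently after the cells are fixed, so its failure probability is
at most `1/6` for every `xs`; the first batch adds another `1/6`. -/
theorem prob_transcript_not_isTypical_le {k d l M r L s N : ℕ} (hk : 0 < k) (hd : 0 < d)
    (hn : 0 < n) (hl : Real.log n ≤ l) (hs : s = k * (d * (2 * l + 2)))
    (hN : N = 6 * d ^ 2 * ((2 * s + 1) * (M + 1))) (μ : PMF (Fin n)) :
    (transcript d M r L s N μ).prob {z | ¬ IsTypical k d M r L s N μ z.1 z.2} ≤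
      ENNReal.ofReal (1 / 3) := by
  classical
  set U : Set (List (Fin n)) := {xs | ¬ ∀ i j, i < j → cellIndex s xs i = cellIndex s xs j →
      ∑ x ∈ Finset.Icc i j, (μ x).toReal ≤ 1 / (d * k)} with hU
  simp only [transcript, PMF.prob_bind, PMF.prob_map]
  calc _ ≤ (μ.iid s).expect fun xs => U.indicator 1 xs + ENNReal.ofReal (1 / 6) := by
        refine PMF.expect_mono _ fun xs => ?_
        by_cases hxs : xs ∈ U
        · rw [Set.indicator_of_mem hxs]
          exact (PMF.prob_le_one _ _).trans le_self_add
        · rw [Set.indicator_of_notMem hxs, zero_add]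
          refine le_trans (PMF.prob_mono _ fun ys hys => ?_) (prob_iid_markedPoint_le hd hN μ xs)
          by_contra hlt
          exact hys ⟨not_not.1 hxs, not_lt.1 hlt⟩
    _ = (μ.iid s).prob U + ENNReal.ofReal (1 / 6) := by
        rw [PMF.expect_add, PMF.expect_const]
        rfl
    _ ≤ ENNReal.ofReal (1 / 6) + ENNReal.ofReal (1 / 6) :=
        add_le_add_left (prob_not_light_le hk hd hn hl hs μ) _
    _ = ENNReal.ofReal (1 / 3) := by
        rw [← ENNReal.ofReal_add (by norm_num) (by norm_num)]
        norm_num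

theorem le_toReal_map_of_prob_le {α β : Type*} (p : PMF α) (f : α → β) (b : β) {s : Set α}
    (hs : ∀ a ∈ s, f a = b) {δ : ℝ} (hδ : 0 ≤ δ) (h : p.prob sᶜ ≤ ENNReal.ofReal δ) :
    1 - δ ≤ (p.map f b).toReal := by
  have ht : ∀ t : Set α, p.prob t ≠ ∞ := fun t =>
    ne_top_of_le_ne_top ENNReal.one_ne_top (p.prob_le_one t)
  have h1 := congrArg ENNReal.toReal (p.prob_add_prob_compl s)
  rw [ENNReal.toReal_add (ht _) (ht _), ENNReal.toReal_one] at h1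
  have h2 : (p.prob sᶜ).toReal ≤ δ := ENNReal.toReal_le_of_le_ofReal hδ h
  have h3 : p.prob s ≤ p.map f b := by
    rw [← PMF.prob_singleton, PMF.prob_map]
    exact p.prob_mono hs
  have h4 := ENNReal.toReal_mono (PMF.apply_ne_top _ _) h3
  linarith

/-- A tolerant tester for the atlases of length at most `k`, with an explicit number of samples. -/
theorem exists_isTolerantTester {S : Set (PMF (Fin n))} {𝔸 : Set (Atlas n)} {k d l : ℕ}
    {η ε : ℝ} (hk : ∀ A ∈ 𝔸, A.length ≤ k) (hS : ∀ μ ∈ S, ∃ A ∈ 𝔸, Conforms μ A)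
    (hA : ∀ A ∈ 𝔸, ∀ μ : PMF (Fin n), Conforms μ A → ¬ IsFar (ε / 5) μ S)
    (hη : 0 < η) (hε : 0 < ε) (hk0 : 0 < k) (hd : 0 < d) (hn : 0 < n) (hl : Real.log n ≤ l)
    (hdε : 50 / ε ≤ d) :
    ∃ (q : ℕ) (T : CondAlg n q),
      q ≤ k * (d * (2 * l + 2) *
        (1 + 18 * d ^ 2 * ((l + 4 * d) * d + 1) *
          (1 + (2 * l + 1) * (16 * (2 * l + 1) * d ^ 3)))) ∧
      IsTolerantTester T S η ε (1 / 3) := by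
  classical
  have hd' : (1 : ℝ) ≤ d := by exact_mod_cast hd
  have hn' : (0 : ℝ) < n := by exact_mod_cast hn
  set L := 2 * l + 1 with hL
  set r := 16 * L * d ^ 3 with hr
  set M := (l + 4 * d) * d with hM
  set s := k * (d * (2 * l + 2)) with hs
  set N := 6 * d ^ 2 * ((2 * s + 1) * (M + 1)) with hN
  have hMle : Real.log (4 * n * d) * d ≤ M := by
    rw [hM]
    push_cast
    gcongr
    rw [show (4 * n * d : ℝ) = n * (4 * d) by ring, Real.log_mul hn'.ne' (by positivity)]
    exact add_le_add hl (Real.log_le_self (by positivity))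
  have h23 : 23 / (d : ℝ) + ε / 5 < ε := by
    have : 23 / (d : ℝ) ≤ 23 / 50 * ε := by
      rw [div_le_iff₀ hε] at hdε
      rw [div_le_iff₀ (by linarith)]
      linarith
    linarith
  set decision : List (Fin n) × List (Fin n × Fin (M + 1)) → Bool := fun z =>
    decide (∃ μ : PMF (Fin n), IsTypical k d M r L s N μ z.1 z.2 ∧
      distToSet μ S ≤ ENNReal.ofReal η) with hdec
  obtain ⟨T, hT⟩ := ((isSampled_transcript hn.ne' d M r L s N).map decision).exists_condAlg
  refine ⟨_, T, ?_, fun μ => ⟨fun hμ => ?_, fun hμ => ?_⟩⟩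
  -- Since `s ≥ 1`, `2 s + 1 ≤ 3 s`; this keeps the whole count linear in `k`.
  · have hs1 : 1 ≤ s := by
      rw [hs]
      exact Nat.succ_le_of_lt (by positivity)
    calc s + N * (1 + L * r) ≤ s + (6 * d ^ 2 * ((3 * s) * (M + 1))) * (1 + L * r) := by
          rw [hN]
          gcongr
          omega
      _ = _ := by
          rw [hs]
          ring
  · rw [hT]
    refine le_toReal_map_of_prob_le _ _ _ (s := {z | IsTypical k d M r L s N μ z.1 z.2})
      (fun z hz => decide_eq_true ⟨μ, hz, hμ⟩) (by norm_num) ?_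
    exact prob_transcript_not_isTypical_le hk0 hd hn hl hs hN μ
  · rw [hT]
    refine le_toReal_map_of_prob_le _ _ _ (s := {z | IsTypical k d M r L s N μ z.1 z.2})
      (fun z hz => decide_eq_false ?_) (by norm_num)
      (prob_transcript_not_isTypical_le hk0 hd hn hl hs hN μ)
    rintro ⟨ν, hν, hνη⟩
    refine absurd hμ (not_le.2 (distToSet_lt_of_perm hk hS hA hη.le h23 hε (fun I hI => ?_) hνη))
    exact exists_perm_of_isTypical hd hn hMle
      (fun μ => prob_markedPoint_not_isAccurate_le hd hn hl hL hr μ) hz hν I hI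

end Tester

theorem mainTheorem4 :
    ∃ P : MvPolynomial (Fin 2) ℝ,
      ∀ (C : DistProperty) (k : ℝ → ℕ → ℕ), IsCharacterizedByAtlases k C →
        ∀ η ε : ℝ, 0 < η → 0 < ε → η + ε < 1 →
          ∀ n : ℕ, ∃ (q : ℕ) (T : CondAlg n q),
            (q : ℝ) ≤ (k (ε / 5) n : ℝ) * MvPolynomial.eval ![Real.log n, 1 / ε] P ∧
            IsTolerantTester T (C n) η ε (1 / 3) := by
  -- `x` and `y` bound `l = ⌈log n⌉` and `d = 50 ⌈1/ε⌉` from above in the sample count of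
  -- `exists_isTolerantTester`.
  set x : MvPolynomial (Fin 2) ℝ := MvPolynomial.X 0 + 1 with hx
  set y : MvPolynomial (Fin 2) ℝ := 50 * (MvPolynomial.X 1 + 1) with hy
  refine ⟨y * (2 * x + 2) * (1 + 18 * y ^ 2 * ((x + 4 * y) * y + 1) *
    (1 + (2 * x + 1) * (16 * (2 * x + 1) * y ^ 3))), fun C k hC η ε hη hε _ n => ?_⟩
  have hlog : 0 ≤ Real.log n := Real.log_natCast_nonneg n
  have hxe : MvPolynomial.eval ![Real.log n, 1 / ε] x = Real.log n + 1 := by simp [hx]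
  have hye : MvPolynomial.eval ![Real.log n, 1 / ε] y = 50 * (1 / ε + 1) := by simp [hy]
  simp only [map_mul, map_add, map_pow, map_one, map_ofNat, hxe, hye]
  rcases Nat.eq_zero_or_pos n with rfl | hn
  · refine ⟨0, .output false, ?_, fun μ => ?_⟩
    · rw [Nat.cast_zero]
      positivity
    · obtain ⟨i, _⟩ := μ.support_nonempty
      exact i.elim0
  obtain ⟨𝔸, hk, hS, hA⟩ := hC n (ε / 5) (by positivity)
  rcases Nat.eq_zero_or_pos (k (ε / 5) n) with hk0 | hk0
  -- Every atlas over a nonempty domain has positive length, so there are none here. All distances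
  -- to the empty property are infinite, and rejecting without samples is correct.
  · have hempty : C n = ∅ := by
      rw [Set.eq_empty_iff_forall_notMem]
      intro μ hμ
      obtain ⟨A, hA𝔸, _⟩ := hS μ hμ
      have h1 : A.partition.length ≤ 0 := hk0 ▸ hk A hA𝔸
      have h2 := A.partition.length_pos_of_pos hn
      omega
    refine ⟨0, .output false, by rw [hk0]; simp, fun μ => ⟨fun h => ?_, fun _ => ?_⟩⟩
    · simp [hempty, distToSet] at h
    · simp only [CondAlg.run, PMF.pure_apply_self, ENNReal.toReal_one]
      norm_num
  set l := ⌈Real.log n⌉₊ with hl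
  set e := ⌈1 / ε⌉₊ with he
  have hle : (l : ℝ) ≤ Real.log n + 1 := (Nat.ceil_lt_add_one hlog).le
  have hee : (e : ℝ) ≤ 1 / ε + 1 := (Nat.ceil_lt_add_one (by positivity)).le
  have he0 : 0 < e := Nat.ceil_pos.2 (by positivity)
  obtain ⟨q, T, hq, hT⟩ := exists_isTolerantTester (d := 50 * e) (l := l) hk hS hA hη hε hk0
    (by positivity) hn (Nat.le_ceil _) (by
      have := Nat.le_ceil (1 / ε)
      push_cast
      calc 50 / ε = 50 * (1 / ε) := by ring
        _ ≤ _ := by gcongr)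
  refine ⟨q, T, ?_, hT⟩
  refine (Nat.cast_le.2 hq).trans ?_
  push_cast
  gcongr
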